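/- Let $\mathbb H^2_{\mathbb C}$ be the complex hyperbolic plane, i.e. the set of negative lines in $\mathbb C^3$ for the Hermitian form $\langle v,w\rangle=v_1\bar w_1+v_2\bar w_2-v_3\bar w_3$, with the metric $d$ of constant holomorphic sectional curvature $-1$, $\cosh^2\frac{d([v],[w])}{2}=\frac{\langle v,w\rangle\langle w,v\rangle}{\langle v,v\rangle\langle w,w\rangle}$, and let $\mathbb H^2_{\mathbb R}\subset\mathbb H^2_{\mathbb C}$ be the totally real geodesic plane of the lines spanned by real vectors (its curvature is $-1/4$). Let $\Gamma\subset PO(2,1)\subset PU(2,1)$ be a non-elementary discrete group, and let $\gamma_\alpha\in\Gamma$ be hyperbolic, i.e. an orientation-preserving isometry of $\mathbb H^2_{\mathbb R}$ that translates along a geodesic $A\subset\mathbb H^2_{\mathbb R}$ (its axis) by a length $\ell>0$. Suppose that $\gamma_\alpha$ represents a simple geodesic: for every $g\in\Gamma$, either $g(A)=A$ or $g(A)\cap A=\emptyset$. Let $\Gamma_0=\{g\in\Gamma: g(A)=A\}$ be the stabilizer of the axis, let $\delta>0$, and let $U_\delta(A)=\{w\in\mathbb H^2_{\mathbb C}: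 d(w,a)<\delta\text{ for some }a\in A\}$. If $$\sinh\left(\frac{\ell}{4}\right)\cdot\sinh\left(\frac{\delta}{2}\right)\le\frac12,$$ then $U_\delta(A)$ is precisely invariant under $\Gamma_0$ in $\Gamma$: $g(U_\delta(A))=U_\delta(A)$ for $g\in\Gamma_0$, and $g(U_\delta(A))\cap U_\delta(A)=\emptyset$ for $g\in\Gamma\setminus\Gamma_0$. If moreover $\ell<4\delta$, and $\Gamma_0=\langle\gamma_\alpha\rangle$ (or, more generally, every element of $\Gamma_0$ acts on $A$ as a power of $\gamma_\alpha$), then for every $z\in A$ the Dirichlet polyhedron $D_z(\Gamma)=\{w\in\mathbb H^2_{\mathbb C}: d(z,w)\le d(g(z),w)\text{ for all }g\in\Gamma\}$ has two distinct sides $\sigma,\sigma'$, each intersecting $A$, with $\gamma_\alpha(\sigma)=\sigma'$. Here a side of $D_z(\Gamma)$ is an intersection of $D_z(\Gamma)$ with a bisector $\{w: d(z,w)=d(g(z),w)\}$, $g\in\Gamma$, $g(z)\ne z$, that has non-empty interior in this bisector. -/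

import Mathlib

open scoped Pointwise LinearAlgebra.Projectivization Matrix

noncomputable section

namespace CplxHyp

/-! ### The groups U(2,1), O(2,1), PU(2,1), PO(2,1) -/

/-- The vector space `ℂ³`, carrying the Hermitian form of signature `(2,1)` below. -/
abbrev V3 : Type := Fin 3 → ℂ

/-- The matrix `diag(1, 1, -1)`. -/
def J (R : Type) [CommRing R] : Matrix (Fin 3) (Fin 3) R := Matrix.diagonal ![1, 1, -1]

/-- The Hermitian form `⟨v, w⟩ = v₀ w̄₀ + v₁ w̄₁ - v₂ w̄₂`. -/
def herm (v w : V3) : ℂ := star w ⬝ᵥ (J ℂ *ᵥ v)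

theorem herm_eq (v w : V3) :
    herm v w = v 0 * star (w 0) + v 1 * star (w 1) - v 2 * star (w 2) := by
  simp [herm, J, dotProduct, Fin.sum_univ_three, Matrix.mulVec_diagonal]
  ring

/-- `U(2,1)`, the matrices with `Mᴴ J M = J`. -/
def U21 : Subgroup (GL (Fin 3) ℂ) where
  carrier := {M | (M : Matrix (Fin 3) (Fin 3) ℂ)ᴴ * J ℂ * (M : Matrix (Fin 3) (Fin 3) ℂ) = J ℂ}
  one_mem' := by simp
  mul_mem' := by
    intro a b ha hb
    simp only [Set.mem_ofPred_eq] at ha hb ⊢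
    rw [Units.val_mul, Matrix.conjTranspose_mul]
    calc _ = (b : Matrix (Fin 3) (Fin 3) ℂ)ᴴ * ((a : Matrix (Fin 3) (Fin 3) ℂ)ᴴ * J ℂ * a) * b := by
          simp only [Matrix.mul_assoc]
      _ = _ := by rw [ha, hb]
  inv_mem' := by
    intro a ha
    simp only [Set.mem_ofPred_eq] at ha ⊢
    have h1 : (a : Matrix (Fin 3) (Fin 3) ℂ) * ((a⁻¹ : GL (Fin 3) ℂ) : Matrix (Fin 3) (Fin 3) ℂ) = 1 := by
      rw [← Units.val_mul, mul_inv_cancel, Units.val_one]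
    have h2 : (((a⁻¹ : GL (Fin 3) ℂ) : Matrix (Fin 3) (Fin 3) ℂ))ᴴ * (a : Matrix (Fin 3) (Fin 3) ℂ)ᴴ = 1 := by
      rw [← Matrix.conjTranspose_mul, h1, Matrix.conjTranspose_one]
    generalize ((a⁻¹ : GL (Fin 3) ℂ) : Matrix (Fin 3) (Fin 3) ℂ) = b at h1 h2 ⊢
    calc bᴴ * J ℂ * b = bᴴ * ((a : Matrix (Fin 3) (Fin 3) ℂ)ᴴ * J ℂ * a) * b := by rw [ha]
      _ = (bᴴ * (a : Matrix (Fin 3) (Fin 3) ℂ)ᴴ) * J ℂ * (a * b) := by simp only [Matrix.mul_assoc]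
      _ = J ℂ := by rw [h1, h2, one_mul, mul_one]

/-- `O(2,1)`, the real matrices with `Mᵀ J M = J`. -/
def O21 : Subgroup (GL (Fin 3) ℝ) where
  carrier := {M | (M : Matrix (Fin 3) (Fin 3) ℝ)ᵀ * J ℝ * (M : Matrix (Fin 3) (Fin 3) ℝ) = J ℝ}
  one_mem' := by simp
  mul_mem' := by
    intro a b ha hb
    simp only [Set.mem_ofPred_eq] at ha hb ⊢
    rw [Units.val_mul, Matrix.transpose_mul]
    calc _ = (b : Matrix (Fin 3) (Fin 3) ℝ)ᵀ * ((a : Matrix (Fin 3) (Fin 3) ℝ)ᵀ * J ℝ * a) * b := by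
          simp only [Matrix.mul_assoc]
      _ = _ := by rw [ha, hb]
  inv_mem' := by
    intro a ha
    simp only [Set.mem_ofPred_eq] at ha ⊢
    have h1 : (a : Matrix (Fin 3) (Fin 3) ℝ) * ((a⁻¹ : GL (Fin 3) ℝ) : Matrix (Fin 3) (Fin 3) ℝ) = 1 := by
      rw [← Units.val_mul, mul_inv_cancel, Units.val_one]
    have h2 : (((a⁻¹ : GL (Fin 3) ℝ) : Matrix (Fin 3) (Fin 3) ℝ))ᵀ * (a : Matrix (Fin 3) (Fin 3) ℝ)ᵀ = 1 := by
      rw [← Matrix.transpose_mul, h1, Matrix.transpose_one]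
    generalize ((a⁻¹ : GL (Fin 3) ℝ) : Matrix (Fin 3) (Fin 3) ℝ) = b at h1 h2 ⊢
    calc bᵀ * J ℝ * b = bᵀ * ((a : Matrix (Fin 3) (Fin 3) ℝ)ᵀ * J ℝ * a) * b := by rw [ha]
      _ = (bᵀ * (a : Matrix (Fin 3) (Fin 3) ℝ)ᵀ) * J ℝ * (a * b) := by simp only [Matrix.mul_assoc]
      _ = J ℝ := by rw [h1, h2, one_mul, mul_one]

theorem complexify_mem (M : O21) :
    Matrix.GeneralLinearGroup.map (n := Fin 3) (algebraMap ℝ ℂ) (M : GL (Fin 3) ℝ) ∈ U21 := by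
  have h : ((M : GL (Fin 3) ℝ) : Matrix (Fin 3) (Fin 3) ℝ)ᵀ * J ℝ
      * ((M : GL (Fin 3) ℝ) : Matrix (Fin 3) (Fin 3) ℝ) = J ℝ := M.2
  generalize hN : ((M : GL (Fin 3) ℝ) : Matrix (Fin 3) (Fin 3) ℝ) = N at h
  have hJ : (J ℝ).map (algebraMap ℝ ℂ) = J ℂ := by
    ext i j; fin_cases i <;> fin_cases j <;> simp [J]
  have hc : (N.map (algebraMap ℝ ℂ))ᴴ = Nᵀ.map (algebraMap ℝ ℂ) := by
    ext i j; simp [Matrix.conjTranspose_apply]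
  have hM : ((Matrix.GeneralLinearGroup.map (n := Fin 3) (algebraMap ℝ ℂ) (M : GL (Fin 3) ℝ) :
      GL (Fin 3) ℂ) : Matrix (Fin 3) (Fin 3) ℂ) = N.map (algebraMap ℝ ℂ) := by
    rw [← hN]; rfl
  change _ᴴ * J ℂ * _ = J ℂ
  rw [hM, hc, ← hJ, ← Matrix.map_mul, ← Matrix.map_mul, h]

/-- The inclusion `O(2,1) ⊂ U(2,1)`. -/
def complexify : O21 →* U21 :=
  ((Matrix.GeneralLinearGroup.map (n := Fin 3) (algebraMap ℝ ℂ)).comp O21.subtype).codRestrict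
    U21 complexify_mem

/-- The scalar matrices in `U(2,1)`. -/
def scalars : Subgroup U21 where
  carrier := {M | ∃ c : ℂ, ((M : GL (Fin 3) ℂ) : Matrix (Fin 3) (Fin 3) ℂ) = c • 1}
  one_mem' := ⟨1, by simp⟩
  mul_mem' := by
    rintro a b ⟨c, hc⟩ ⟨d, hd⟩
    exact ⟨c * d, by simp [hc, hd, smul_smul, mul_comm]⟩
  inv_mem' := by
    rintro a ⟨c, hc⟩
    have h1 : ((a : GL (Fin 3) ℂ) : Matrix (Fin 3) (Fin 3) ℂ)
        * (((a⁻¹ : U21) : GL (Fin 3) ℂ) : Matrix (Fin 3) (Fin 3) ℂ) = 1 := by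
      rw [← Units.val_mul, ← Subgroup.coe_mul, mul_inv_cancel]; rfl
    rw [hc, smul_mul_assoc, one_mul] at h1
    have h0 : c ≠ 0 := by
      rintro rfl
      simpa using congrFun (congrFun h1 0) 0
    exact ⟨c⁻¹, by rw [← h1, smul_smul, inv_mul_cancel₀ h0, one_smul]⟩

instance : scalars.Normal where
  conj_mem := by
    rintro a ⟨c, hc⟩ g
    refine ⟨c, ?_⟩
    have h1 : ((g : GL (Fin 3) ℂ) : Matrix (Fin 3) (Fin 3) ℂ)
        * (((g⁻¹ : U21) : GL (Fin 3) ℂ) : Matrix (Fin 3) (Fin 3) ℂ) = 1 := by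
      rw [← Units.val_mul, ← Subgroup.coe_mul, mul_inv_cancel]; rfl
    rw [Subgroup.coe_mul, Subgroup.coe_mul, Units.val_mul, Units.val_mul, hc, mul_smul_comm,
      mul_one, smul_mul_assoc, h1]

/-- `PU(2,1)`, with the quotient topology of the matrix topology. -/
abbrev PU21 : Type := U21 ⧸ scalars

/-- `PO(2,1)`, the image of `O(2,1)` in `PU(2,1)`. -/
def PO21 : Subgroup PU21 := ((QuotientGroup.mk' scalars).comp complexify).range

/-! ### The complex hyperbolic plane -/

theorem U21_smul_def (M : U21) (v : V3) :
    M • v = ((M : GL (Fin 3) ℂ) : Matrix (Fin 3) (Fin 3) ℂ) *ᵥ v := rfl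

theorem U21_smul_mk (M : U21) (v : V3) (hv : v ≠ 0) :
    M • Projectivization.mk ℂ v hv
      = Projectivization.mk ℂ (M • v) ((smul_ne_zero_iff_ne M).2 hv) := rfl

theorem scalars_le_ker :
    scalars ≤ (MulAction.toPermHom U21 (ℙ ℂ V3)).ker := by
  rintro M ⟨c, hc⟩
  rw [MonoidHom.mem_ker]
  ext p
  induction p using Projectivization.ind with
  | h v hv =>
    have h : M • v = c • v := by rw [U21_smul_def, hc, Matrix.smul_mulVec, Matrix.one_mulVec]
    simp only [MulAction.toPermHom_apply, MulAction.toPerm_apply, Equiv.Perm.coe_one, id_eq]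
    exact (Projectivization.mk_eq_mk_iff' ℂ _ _ _ _).2 ⟨c, h.symm⟩

/-- The projective action of `PU(2,1)` on the lines of `ℂ³`. -/
instance : MulAction PU21 (ℙ ℂ V3) :=
  MulAction.compHom _ (QuotientGroup.lift scalars (MulAction.toPermHom U21 (ℙ ℂ V3)) scalars_le_ker)

theorem mk_smul (M : U21) (p : ℙ ℂ V3) : (QuotientGroup.mk M : PU21) • p = M • p := rfl

theorem herm_smul (M : U21) (v w : V3) : herm (M • v) (M • w) = herm v w := by
  have h : ((M : GL (Fin 3) ℂ) : Matrix (Fin 3) (Fin 3) ℂ)ᴴ * J ℂ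
    * ((M : GL (Fin 3) ℂ) : Matrix (Fin 3) (Fin 3) ℂ) = J ℂ := M.2
  rw [U21_smul_def, U21_smul_def, herm, herm, Matrix.star_mulVec, ← Matrix.dotProduct_mulVec,
    Matrix.mulVec_mulVec, Matrix.mulVec_mulVec, h]

theorem herm_smul_smul (a b : ℂ) (v w : V3) :
    herm (a • v) (b • w) = a * star b * herm v w := by
  simp only [herm_eq, Pi.smul_apply, smul_eq_mul, star_mul']
  ring

/-- A line of `ℂ³` is negative if the Hermitian form is negative on it. -/
def IsNeg (p : ℙ ℂ V3) : Prop := (herm p.rep p.rep).re < 0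

theorem isNeg_mk (v : V3) (hv : v ≠ 0) :
    IsNeg (Projectivization.mk ℂ v hv) ↔ (herm v v).re < 0 := by
  obtain ⟨a, ha⟩ := Projectivization.exists_smul_eq_mk_rep ℂ v hv
  have h0 : 0 < Complex.normSq (a : ℂ) := Complex.normSq_pos.2 a.ne_zero
  rw [IsNeg, ← ha, Units.smul_def, herm_smul_smul, ← starRingEnd_apply, Complex.mul_conj,
    Complex.re_ofReal_mul]
  exact ⟨fun h => by nlinarith, fun h => by nlinarith⟩

theorem isNeg_smul (g : PU21) (p : ℙ ℂ V3) (hp : IsNeg p) : IsNeg (g • p) := by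
  induction g using QuotientGroup.induction_on with
  | H M =>
    induction p using Projectivization.ind with
    | h v hv =>
      rw [mk_smul, U21_smul_mk, isNeg_mk, herm_smul]
      exact (isNeg_mk v hv).1 hp

/-- The complex hyperbolic plane: the negative lines of `ℂ³`. -/
def CH2 : Type := {p : ℙ ℂ V3 // IsNeg p}

instance : MulAction PU21 CH2 where
  smul g x := ⟨g • x.1, isNeg_smul g x.1 x.2⟩
  one_smul x := Subtype.ext (one_smul PU21 x.1)
  mul_smul g h x := Subtype.ext (mul_smul g h x.1)

/-- The distance of the complex hyperbolic plane with holomorphic sectional curvature `-1`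
(sectional curvature in `[-1, -1/4]`):
`cosh² (d(x, y) / 2) = ⟨v, w⟩⟨w, v⟩ / (⟨v, v⟩⟨w, w⟩)` for `x = [v]`, `y = [w]`. -/
def chDist (x y : CH2) : ℝ :=
  2 * Real.arcosh (‖herm x.1.rep y.1.rep‖ /
    √((herm x.1.rep x.1.rep).re * (herm y.1.rep y.1.rep).re))

/-- The distance does not depend on the representatives. -/
theorem chDist_mk (v w : V3) (hv : v ≠ 0) (hw : w ≠ 0)
    (h : IsNeg (Projectivization.mk ℂ v hv)) (h' : IsNeg (Projectivization.mk ℂ w hw)) :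
    chDist ⟨Projectivization.mk ℂ v hv, h⟩ ⟨Projectivization.mk ℂ w hw, h'⟩ =
      2 * Real.arcosh (‖herm v w‖ / √((herm v v).re * (herm w w).re)) := by
  obtain ⟨a, ha⟩ := Projectivization.exists_smul_eq_mk_rep ℂ v hv
  obtain ⟨b, hb⟩ := Projectivization.exists_smul_eq_mk_rep ℂ w hw
  have h1 : 0 < ‖(a : ℂ)‖ := norm_pos_iff.2 a.ne_zero
  have h2 : 0 < ‖(b : ℂ)‖ := norm_pos_iff.2 b.ne_zero
  unfold chDist
  simp only
  rw [← ha, ← hb, Units.smul_def, Units.smul_def, herm_smul_smul, herm_smul_smul, herm_smul_smul,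
    ← starRingEnd_apply, ← starRingEnd_apply, Complex.mul_conj, Complex.mul_conj,
    Complex.re_ofReal_mul, Complex.re_ofReal_mul, Complex.normSq_eq_norm_sq,
    Complex.normSq_eq_norm_sq, norm_mul, norm_mul, RCLike.norm_conj,
    show ‖(a : ℂ)‖ ^ 2 * (herm v v).re * (‖(b : ℂ)‖ ^ 2 * (herm w w).re)
      = (‖(a : ℂ)‖ * ‖(b : ℂ)‖) ^ 2 * ((herm v v).re * (herm w w).re) by ring,
    Real.sqrt_mul (sq_nonneg _), Real.sqrt_sq (by positivity),
    mul_div_mul_left _ _ (by positivity)]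

/-- The totally real geodesic plane `H²_ℝ ⊂ H²_ℂ`: the negative lines spanned by real vectors. -/
def RH2 : Set CH2 :=
  {x | ∃ (v : Fin 3 → ℝ) (hv : (fun i => (v i : ℂ)) ≠ 0),
    x.1 = Projectivization.mk ℂ (fun i => (v i : ℂ)) hv}

/-! ### Discrete groups, axes, tubular neighborhoods, Dirichlet polyhedra -/

/-- `Γ` is non-elementary: it has no finite orbit in the closure of the complex hyperbolic plane
(the non-positive lines, that is, the closed unit ball). -/
def IsNonElementary (Γ : Subgroup PU21) : Prop :=
  ∀ p : ℙ ℂ V3, (herm p.rep p.rep).re ≤ 0 → (MulAction.orbit Γ p).Infinite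

/-- `γ` acts on `H²_ℝ` as an orientation-preserving isometry: it is represented by a matrix of the
identity component of `O(2,1)`. -/
def IsOrientationPreserving (γ : PU21) : Prop :=
  ∃ M : O21, QuotientGroup.mk (complexify M) = γ ∧
    ((M : GL (Fin 3) ℝ) : Matrix (Fin 3) (Fin 3) ℝ).det = 1 ∧
    0 < ((M : GL (Fin 3) ℝ) : Matrix (Fin 3) (Fin 3) ℝ) 2 2

/-- `γ` is a hyperbolic isometry of `H²_ℝ` with axis `A` and translation length `ℓ`: it preserves
the orientation, and it translates by `ℓ > 0` along a unit-speed parametrization `c` of the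
geodesic line `A ⊂ H²_ℝ`. -/
def IsHyperbolicWith (γ : PU21) (A : Set CH2) (ℓ : ℝ) : Prop :=
  IsOrientationPreserving γ ∧ 0 < ℓ ∧
    ∃ c : ℝ → CH2, Set.range c = A ∧ A ⊆ RH2 ∧ (∀ s t, chDist (c s) (c t) = |s - t|) ∧
      ∀ t, γ • c t = c (t + ℓ)

/-- The (open) tubular neighborhood of radius `δ` of `A` in `H²_ℂ`. -/
def tube (A : Set CH2) (δ : ℝ) : Set CH2 := {w | ∃ a ∈ A, chDist w a < δ}

/-- `U` is precisely invariant with respect to `Γ₀` in `Γ`. -/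
def IsPreciselyInvariant (Γ Γ₀ : Subgroup PU21) (U : Set CH2) : Prop :=
  (∀ g ∈ Γ₀, g • U = U) ∧ ∀ g ∈ Γ, g ∉ Γ₀ → (g • U) ∩ U = ∅

/-- The stabilizer of the set `A` in `Γ`. -/
def stab (Γ : Subgroup PU21) (A : Set CH2) : Subgroup PU21 := Γ ⊓ MulAction.stabilizer PU21 A

/-- The bisector of two points. -/
def bisector (x y : CH2) : Set CH2 := {w | chDist x w = chDist y w}

/-- The Dirichlet polyhedron of `Γ` centered at `z`. -/
def dirichlet (Γ : Subgroup PU21) (z : CH2) : Set CH2 :=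
  {w | ∀ g ∈ Γ, chDist z w ≤ chDist (g • z) w}

/-- The sides of the Dirichlet polyhedron: its intersections with the bisectors of `z` and other
orbit points that have non-empty interior in the bisector (so are of codimension one). -/
def IsSide (Γ : Subgroup PU21) (z : CH2) (σ : Set CH2) : Prop :=
  ∃ g ∈ Γ, g • z ≠ z ∧ σ = dirichlet Γ z ∩ bisector z (g • z) ∧
    ∃ w ∈ σ, ∃ ε > 0, ∀ u ∈ bisector z (g • z), chDist u w < ε → u ∈ σ

end CplxHyp

end

noncomputable section

namespace CplxHyp

/-! ### The metric of the complex hyperbolic plane -/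

/-! Everything reduces to one estimate: points of the axis $A$ and of a different translate $gA$ are
at distance at least $2\delta$. The triangle inequality of the complex hyperbolic plane turns this
into disjoint tubes, and it also keeps orbit points off $A$ away from the sides.

The estimate lives in the real Lorentz space. A geodesic of the real plane is the orthogonal plane
of a unit spacelike normal. Because the curvature is $-1/4$, a translation of length $\ell$ is a
Lorentz boost with parameter $L=\ell/2$. Let $n$ and $m$ be the normals of $A$ and $gA$, and let
$C=|\langle m,n\rangle|$. If $C<1$, the geodesics cross (`geod_inter_nonempty`), against simplicity.
If $C=1$, they are asymptotic or equal, and discreteness excludes asymptotic ones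
(`conjNormal_eq_of_abs_eq_one`). So $C>1$, and $C\le\cosh(d/2)$ for any two points of the geodesics
at distance $d$ (`abs_lor_le_cosh`).

The collar bound $(\cosh L-1)(C-1)\ge 1$ (`one_le_of_smul_ne`) comes from replacing $g$ by $g\gamma
g^{-1}$. This gives another translate of $A$, whose constant $C'$ satisfies $C'+1=(\cosh
L-1)(C-1)(C+1)$. If the bound failed, iteration would push $C+1$ below $2$, although every translate
obtained has $C>1$. Half-angle formulas and the hypothesis on $\ell,\delta$ then give
$\cosh\delta\le C$.

For the Dirichlet polyhedron, the midpoints of $z$ and $\gamma^{\pm1}z$ are strictly closer to these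
two points than to any other orbit point. A neighbourhood of each midpoint in its bisector therefore
lies in the polyhedron (`dirichlet_sides`). -/

theorem herm_add_left (x y z : V3) : herm (x + y) z = herm x z + herm y z := by
  simp only [herm_eq, Pi.add_apply]; ring

theorem herm_add_right (x y z : V3) : herm x (y + z) = herm x y + herm x z := by
  simp only [herm_eq, Pi.add_apply, star_add]; ring

theorem herm_smul_left (a : ℂ) (x y : V3) : herm (a • x) y = a * herm x y := by
  simp only [herm_eq, Pi.smul_apply, smul_eq_mul]; ring

theorem herm_smul_right (a : ℂ) (x y : V3) : herm x (a • y) = star a * herm x y := by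
  simp only [herm_eq, Pi.smul_apply, smul_eq_mul, star_mul']; ring

theorem star_herm (x y : V3) : star (herm x y) = herm y x := by
  simp only [herm_eq, star_add, star_sub, star_mul', star_star]; ring

theorem herm_self (v : V3) :
    herm v v = ((‖v 0‖ ^ 2 + ‖v 1‖ ^ 2 - ‖v 2‖ ^ 2 : ℝ) : ℂ) := by
  simp only [herm_eq, ← starRingEnd_apply, Complex.mul_conj, Complex.normSq_eq_norm_sq]
  push_cast; ring

theorem herm_self_eq_re (v : V3) : herm v v = ((herm v v).re : ℂ) := by
  rw [herm_self, Complex.ofReal_re]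

/-- The orthogonal complement of a negative vector is positive definite. -/
theorem herm_self_pos_of_orthogonal {p w : V3} (hw : (herm w w).re < 0) (h : herm p w = 0)
    (hp : p ≠ 0) : 0 < (herm p p).re := by
  rw [herm_self, Complex.ofReal_re] at hw ⊢
  have h1 : p 2 * star (w 2) = p 0 * star (w 0) + p 1 * star (w 1) := by
    rw [herm_eq] at h; linear_combination -h
  have h2 : ‖p 2‖ * ‖w 2‖ ≤ ‖p 0‖ * ‖w 0‖ + ‖p 1‖ * ‖w 1‖ := by
    have := norm_add_le (p 0 * star (w 0)) (p 1 * star (w 1))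
    rw [← h1] at this
    simpa only [norm_mul, norm_star] using this
  by_contra hcon
  -- If $\langle p,p\rangle\le 0$, Cauchy–Schwarz in the first two coordinates contradicts the
  -- negativity of $w$ unless the last coordinate of $p$ vanishes.
  have hz : ‖p 2‖ ^ 2 = 0 := by
    have h3 : (‖p 2‖ * ‖w 2‖) ^ 2 ≤ (‖p 0‖ * ‖w 0‖ + ‖p 1‖ * ‖w 1‖) ^ 2 := by gcongr
    have h4 : (‖p 0‖ * ‖w 0‖ + ‖p 1‖ * ‖w 1‖) ^ 2
        ≤ (‖p 0‖ ^ 2 + ‖p 1‖ ^ 2) * (‖w 0‖ ^ 2 + ‖w 1‖ ^ 2) := by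
      nlinarith [sq_nonneg (‖p 0‖ * ‖w 1‖ - ‖p 1‖ * ‖w 0‖)]
    have h5 : (‖p 0‖ ^ 2 + ‖p 1‖ ^ 2) * (‖w 0‖ ^ 2 + ‖w 1‖ ^ 2)
        ≤ ‖p 2‖ ^ 2 * (‖w 0‖ ^ 2 + ‖w 1‖ ^ 2) := by
      gcongr; linarith
    nlinarith [sq_nonneg ‖p 2‖]
  have h0 : ‖p 0‖ ^ 2 = 0 := by nlinarith [sq_nonneg ‖p 0‖, sq_nonneg ‖p 1‖]
  have h1' : ‖p 1‖ ^ 2 = 0 := by nlinarith [sq_nonneg ‖p 0‖, sq_nonneg ‖p 1‖]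
  apply hp
  ext i
  fin_cases i
  · simpa using h0
  · simpa using h1'
  · simpa using hz

theorem herm_self_nonneg_of_orthogonal {p w : V3} (hw : (herm w w).re < 0) (h : herm p w = 0) :
    0 ≤ (herm p p).re := by
  by_cases hp : p = 0
  · simp [hp, herm_eq]
  · exact (herm_self_pos_of_orthogonal hw h hp).le

/-- The Cauchy-Schwarz inequality on the orthogonal complement of a negative vector. -/
theorem norm_herm_sq_le {p q w : V3} (hw : (herm w w).re < 0) (hp : herm p w = 0)
    (hq : herm q w = 0) : ‖herm p q‖ ^ 2 ≤ (herm p p).re * (herm q q).re := by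
  by_cases h0 : q = 0
  · simp [h0, herm_eq]
  have hpos := herm_self_pos_of_orthogonal hw hq h0
  -- Up to the factor $\langle q,q\rangle$, this is the component of $p$ orthogonal to $q$.
  have hr := herm_self_nonneg_of_orthogonal (p := herm q q • p + (-herm p q) • q) hw
    (by rw [herm_add_left, herm_smul_left, herm_smul_left, hp, hq]; simp)
  have key : herm (herm q q • p + (-herm p q) • q) (herm q q • p + (-herm p q) • q)
      = (((herm q q).re * ((herm p p).re * (herm q q).re - ‖herm p q‖ ^ 2) : ℝ) : ℂ) := by
    simp only [herm_add_left, herm_add_right, herm_smul_left, herm_smul_right, star_neg, star_herm]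
    have e : herm p q * herm q p = ((‖herm p q‖ ^ 2 : ℝ) : ℂ) := by
      rw [← star_herm p q, ← starRingEnd_apply, Complex.mul_conj, Complex.normSq_eq_norm_sq]
    push_cast at e ⊢
    rw [← herm_self_eq_re p, ← herm_self_eq_re q, ← e]
    ring
  rw [key, Complex.ofReal_re] at hr
  have := (mul_nonneg_iff_of_pos_left hpos).1 hr
  linarith

theorem exists_unit_rep (x : CH2) : ∃ (v : V3) (hv : v ≠ 0), x.1 = Projectivization.mk ℂ v hv ∧
    herm v v = -1 := by
  have hx : (herm x.1.rep x.1.rep).re < 0 := x.2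
  set r := (herm x.1.rep x.1.rep).re with hr
  have hs : 0 < √(-r) := Real.sqrt_pos.2 (by linarith)
  have hs' : ((√(-r))⁻¹ : ℂ) ≠ 0 := inv_ne_zero (by exact_mod_cast hs.ne')
  refine ⟨((√(-r))⁻¹ : ℂ) • x.1.rep, smul_ne_zero hs' x.1.rep_nonzero, ?_, ?_⟩
  · conv_lhs => rw [← x.1.mk_rep]
    refine (Projectivization.mk_eq_mk_iff' ℂ _ _ _ _).2 ⟨(√(-r) : ℂ), ?_⟩
    rw [smul_smul, mul_inv_cancel₀ (by exact_mod_cast hs.ne'), one_smul]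
  · rw [herm_smul_smul, herm_self_eq_re, ← hr, ← starRingEnd_apply, map_inv₀, Complex.conj_ofReal]
    have : (√(-r)) ^ 2 = -r := Real.sq_sqrt (by linarith)
    have h2 : (√(-r))⁻¹ * (√(-r))⁻¹ * r = -1 := by
      field_simp
      linarith
    exact_mod_cast h2

theorem chDist_of_unit {x y : CH2} {v w : V3} (hv : v ≠ 0) (hw : w ≠ 0)
    (hx : x.1 = Projectivization.mk ℂ v hv) (hy : y.1 = Projectivization.mk ℂ w hw)
    (h1 : herm v v = -1) (h2 : herm w w = -1) : chDist x y = 2 * Real.arcosh ‖herm v w‖ := by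
  obtain ⟨x, hx'⟩ := x
  obtain ⟨y, hy'⟩ := y
  obtain rfl := hx
  obtain rfl := hy
  rw [chDist_mk, h1, h2]
  norm_num

/-- This is the projection of $v$ to $w^\perp$; the plus sign is due to $\langle w,w\rangle=-1$. Its
square norm is $\cosh^2(d/2)-1=\sinh^2(d/2)$. -/
theorem herm_projection {v w : V3} (hv : herm v v = -1) (hw : herm w w = -1) :
    herm (v + herm v w • w) w = 0 ∧
      (herm (v + herm v w • w) (v + herm v w • w)).re = ‖herm v w‖ ^ 2 - 1 := by
  have h0 : herm (v + herm v w • w) w = 0 := by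
    rw [herm_add_left, herm_smul_left, hw]; ring
  refine ⟨h0, ?_⟩
  rw [herm_add_right, herm_smul_right, h0, mul_zero, add_zero, herm_add_left, herm_smul_left, hv,
    ← star_herm v w, ← starRingEnd_apply, Complex.mul_conj, Complex.normSq_eq_norm_sq]
  simp only [Complex.add_re, Complex.neg_re, Complex.one_re, Complex.ofReal_re]
  ring

theorem one_le_norm_herm {v w : V3} (hv : herm v v = -1) (hw : herm w w = -1) :
    1 ≤ ‖herm v w‖ := by
  obtain ⟨h0, h1⟩ := herm_projection hv hw
  have := herm_self_nonneg_of_orthogonal (by rw [hw]; norm_num) h0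
  rw [h1] at this
  nlinarith [norm_nonneg (herm v w)]

theorem chDist_comm (x y : CH2) : chDist x y = chDist y x := by
  obtain ⟨v, hv, hx, h1⟩ := exists_unit_rep x
  obtain ⟨w, hw, hy, h2⟩ := exists_unit_rep y
  rw [chDist_of_unit hv hw hx hy h1 h2, chDist_of_unit hw hv hy hx h2 h1, ← star_herm v w,
    norm_star]

/-- Project the outer points to the complement of the middle one. The projections have norms $\sinh
a$, $\sinh b$ for the half-distances $a,b$, so Cauchy–Schwarz gives $|\langle v,u\rangle|\le\cosh
a\cosh b+\sinh a\sinh b=\cosh(a+b)$. -/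
theorem chDist_triangle (x y z : CH2) : chDist x z ≤ chDist x y + chDist y z := by
  obtain ⟨v, hv, hx, h1⟩ := exists_unit_rep x
  obtain ⟨w, hw, hy, h2⟩ := exists_unit_rep y
  obtain ⟨u, hu, hz, h3⟩ := exists_unit_rep z
  rw [chDist_comm y z, chDist_of_unit hv hw hx hy h1 h2, chDist_of_unit hu hw hz hy h3 h2,
    chDist_of_unit hv hu hx hz h1 h3, ← mul_add]
  have ha := one_le_norm_herm h1 h2
  have hb := one_le_norm_herm h3 h2
  have hc := one_le_norm_herm h1 h3
  obtain ⟨p0, p1⟩ := herm_projection h1 h2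
  obtain ⟨q0, q1⟩ := herm_projection h3 h2
  have cs := norm_herm_sq_le (w := w) (by rw [h2]; norm_num) p0 q0
  have e : herm (v + herm v w • w) (u + herm u w • w) = herm v u + herm v w * star (herm u w) := by
    rw [herm_add_right, herm_smul_right, p0, mul_zero, add_zero, herm_add_left, herm_smul_left,
      star_herm]
  rw [p1, q1, e] at cs
  have hle : ‖herm v u‖ ≤ Real.cosh (Real.arcosh ‖herm v w‖ + Real.arcosh ‖herm u w‖) := by
    rw [Real.cosh_add, Real.cosh_arcosh ha, Real.cosh_arcosh hb, Real.sinh_arcosh ha,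
      Real.sinh_arcosh hb, ← Real.sqrt_mul (by nlinarith)]
    have t1 : ‖herm v u‖ ≤ ‖herm v u + herm v w * star (herm u w)‖
        + ‖herm v w * star (herm u w)‖ := by
      simpa using norm_sub_le (herm v u + herm v w * star (herm u w)) (herm v w * star (herm u w))
    rw [norm_mul, norm_star] at t1
    have t2 := Real.le_sqrt_of_sq_le cs
    linarith
  have := (Real.arcosh_le_arcosh (by linarith) (Real.cosh_pos _)).2 hle
  rw [Real.arcosh_cosh (add_nonneg (Real.arcosh_nonneg ha) (Real.arcosh_nonneg hb))] at this
  linarith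

theorem chDist_smul (g : PU21) (x y : CH2) : chDist (g • x) (g • y) = chDist x y := by
  induction g using QuotientGroup.induction_on with
  | H M =>
    obtain ⟨v, hv, hx, h1⟩ := exists_unit_rep x
    obtain ⟨w, hw, hy, h2⟩ := exists_unit_rep y
    rw [chDist_of_unit hv hw hx hy h1 h2,
      chDist_of_unit (v := M • v) (w := M • w) ((smul_ne_zero_iff_ne M).2 hv)
        ((smul_ne_zero_iff_ne M).2 hw) _ _ (by rw [herm_smul, h1]) (by rw [herm_smul, h2]),
      herm_smul]
    · change (QuotientGroup.mk M : PU21) • x.1 = _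
      rw [hx, mk_smul, U21_smul_mk]
    · change (QuotientGroup.mk M : PU21) • y.1 = _
      rw [hy, mk_smul, U21_smul_mk]

/-! ### The real Lorentz form -/

/-- The real quadratic form of signature `(2,1)`. -/
def lor (x y : Fin 3 → ℝ) : ℝ := x 0 * y 0 + x 1 * y 1 - x 2 * y 2

/-- The cross product of the real Lorentz form. -/
def lcross (x y : Fin 3 → ℝ) : Fin 3 → ℝ :=
  ![x 1 * y 2 - x 2 * y 1, x 2 * y 0 - x 0 * y 2, x 1 * y 0 - x 0 * y 1]

theorem lor_comm (x y : Fin 3 → ℝ) : lor x y = lor y x := by simp only [lor]; ring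

theorem lor_add_left (x y z : Fin 3 → ℝ) : lor (x + y) z = lor x z + lor y z := by
  simp only [lor, Pi.add_apply]; ring

theorem lor_add_right (x y z : Fin 3 → ℝ) : lor x (y + z) = lor x y + lor x z := by
  simp only [lor, Pi.add_apply]; ring

theorem lor_sub_left (x y z : Fin 3 → ℝ) : lor (x - y) z = lor x z - lor y z := by
  simp only [lor, Pi.sub_apply]; ring

theorem lor_sub_right (x y z : Fin 3 → ℝ) : lor x (y - z) = lor x y - lor x z := by
  simp only [lor, Pi.sub_apply]; ring

theorem lor_smul_left (a : ℝ) (x y : Fin 3 → ℝ) : lor (a • x) y = a * lor x y := by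
  simp only [lor, Pi.smul_apply, smul_eq_mul]; ring

theorem lor_smul_right (a : ℝ) (x y : Fin 3 → ℝ) : lor x (a • y) = a * lor x y := by
  simp only [lor, Pi.smul_apply, smul_eq_mul]; ring

theorem lor_neg_left (x y : Fin 3 → ℝ) : lor (-x) y = -lor x y := by
  simp only [lor, Pi.neg_apply]; ring

theorem lor_neg_right (x y : Fin 3 → ℝ) : lor x (-y) = -lor x y := by
  simp only [lor, Pi.neg_apply]; ring

theorem lor_zero_left (x : Fin 3 → ℝ) : lor 0 x = 0 := by simp [lor]

theorem eq_of_lor_eq {x y : Fin 3 → ℝ} (h : ∀ z, lor x z = lor y z) : x = y := by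
  ext i
  have := h (Pi.single i 1)
  fin_cases i <;> simpa [lor] using this

theorem lcross_apply_zero (x y : Fin 3 → ℝ) : lcross x y 0 = x 1 * y 2 - x 2 * y 1 := rfl
theorem lcross_apply_one (x y : Fin 3 → ℝ) : lcross x y 1 = x 2 * y 0 - x 0 * y 2 := rfl
theorem lcross_apply_two (x y : Fin 3 → ℝ) : lcross x y 2 = x 1 * y 0 - x 0 * y 1 := rfl

theorem ext_three {x y : Fin 3 → ℝ} (h0 : x 0 = y 0) (h1 : x 1 = y 1) (h2 : x 2 = y 2) :
    x = y := by
  ext i; fin_cases i <;> assumption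

theorem lcross_lcross_left (x y z : Fin 3 → ℝ) :
    lcross (lcross x y) z = lor y z • x - lor x z • y := by
  apply ext_three <;> simp only [lcross_apply_zero, lcross_apply_one, lcross_apply_two,
    Pi.sub_apply, Pi.smul_apply, smul_eq_mul, lor] <;> ring

theorem lcross_lcross_right (x y z : Fin 3 → ℝ) :
    lcross z (lcross x y) = lor x z • y - lor y z • x := by
  apply ext_three <;> simp only [lcross_apply_zero, lcross_apply_one, lcross_apply_two,
    Pi.sub_apply, Pi.smul_apply, smul_eq_mul, lor] <;> ring

/-- The Lagrange identity, with the sign opposite to the Euclidean one: two vectors spanning a plane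
of signature $(1,1)$ have a spacelike cross product. -/
theorem lor_lcross_lcross (x y z t : Fin 3 → ℝ) :
    lor (lcross x y) (lcross z t) = lor x t * lor y z - lor x z * lor y t := by
  simp only [lcross_apply_zero, lcross_apply_one, lcross_apply_two, lor]; ring

theorem lor_lcross_self_left (x y : Fin 3 → ℝ) : lor (lcross x y) x = 0 := by
  simp only [lcross_apply_zero, lcross_apply_one, lcross_apply_two, lor]; ring

theorem lor_lcross_self_right (x y : Fin 3 → ℝ) : lor (lcross x y) y = 0 := by
  simp only [lcross_apply_zero, lcross_apply_one, lcross_apply_two, lor]; ring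

theorem lor_lcross_left_comm (m x y : Fin 3 → ℝ) : lor (lcross m x) y = -lor (lcross m y) x := by
  simp only [lcross_apply_zero, lcross_apply_one, lcross_apply_two, lor]; ring

theorem lcross_add_right (x y z : Fin 3 → ℝ) : lcross x (y + z) = lcross x y + lcross x z := by
  apply ext_three <;> simp only [lcross_apply_zero, lcross_apply_one, lcross_apply_two,
    Pi.add_apply] <;> ring

theorem lcross_smul_right (a : ℝ) (x y : Fin 3 → ℝ) : lcross x (a • y) = a • lcross x y := by
  apply ext_three <;> simp only [lcross_apply_zero, lcross_apply_one, lcross_apply_two,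
    Pi.smul_apply, smul_eq_mul] <;> ring

theorem lcross_smul_left (a : ℝ) (x y : Fin 3 → ℝ) : lcross (a • x) y = a • lcross x y := by
  apply ext_three <;> simp only [lcross_apply_zero, lcross_apply_one, lcross_apply_two,
    Pi.smul_apply, smul_eq_mul] <;> ring

theorem lcross_neg_left (x y : Fin 3 → ℝ) : lcross (-x) y = -lcross x y := by
  apply ext_three <;> simp only [lcross_apply_zero, lcross_apply_one, lcross_apply_two,
    Pi.neg_apply] <;> ring

theorem lcross_self (x : Fin 3 → ℝ) : lcross x x = 0 := by
  apply ext_three <;> simp only [lcross_apply_zero, lcross_apply_one, lcross_apply_two,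
    Pi.zero_apply] <;> ring

/-- The orthogonal complement of a timelike vector is positive definite. -/
theorem lor_self_pos_of_orthogonal {p w : Fin 3 → ℝ} (hw : lor w w < 0) (h : lor p w = 0)
    (hp : p ≠ 0) : 0 < lor p p := by
  simp only [lor] at *
  by_contra hcon
  have e : p 2 * w 2 = p 0 * w 0 + p 1 * w 1 := by linarith
  have h3 : p 2 ^ 2 * w 2 ^ 2 ≤ (p 0 ^ 2 + p 1 ^ 2) * (w 0 ^ 2 + w 1 ^ 2) := by
    rw [← mul_pow, e]; nlinarith [sq_nonneg (p 0 * w 1 - p 1 * w 0)]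
  have h5 : (p 0 ^ 2 + p 1 ^ 2) * (w 0 ^ 2 + w 1 ^ 2) ≤ p 2 ^ 2 * (w 0 ^ 2 + w 1 ^ 2) := by
    gcongr; linarith
  have hz : p 2 ^ 2 = 0 := by nlinarith [sq_nonneg (p 2)]
  have h0 : p 0 ^ 2 = 0 := by nlinarith [sq_nonneg (p 0), sq_nonneg (p 1)]
  have h1 : p 1 ^ 2 = 0 := by nlinarith [sq_nonneg (p 0), sq_nonneg (p 1)]
  exact hp (ext_three (by simpa using h0) (by simpa using h1) (by simpa using hz))

/-- The reversed Cauchy-Schwarz inequality. -/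
theorem lor_mul_lor_le {x : Fin 3 → ℝ} (hx : lor x x < 0) (z : Fin 3 → ℝ) :
    lor x x * lor z z ≤ lor x z ^ 2 := by
  have h : 0 ≤ lor (lcross x z) (lcross x z) := by
    by_cases h0 : lcross x z = 0
    · rw [h0, lor_zero_left]
    · exact (lor_self_pos_of_orthogonal hx (lor_lcross_self_left x z) h0).le
  rw [lor_lcross_lcross, lor_comm z x] at h
  linarith

/-- Cauchy–Schwarz in the spacelike coordinates bounds their contribution strictly by $x_2y_2$. This
settles the signs that the distance formula loses in its absolute value. -/
theorem lor_neg_of_forward {x y : Fin 3 → ℝ} (hx : lor x x < 0) (hy : lor y y < 0)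
    (hx2 : 0 < x 2) (hy2 : 0 < y 2) : lor x y < 0 := by
  simp only [lor] at *
  by_contra hcon
  have h1 : x 2 * y 2 ≤ x 0 * y 0 + x 1 * y 1 := by linarith
  have h2 : (x 2 * y 2) ^ 2 ≤ (x 0 * y 0 + x 1 * y 1) ^ 2 := by gcongr
  have h3 : (x 0 * y 0 + x 1 * y 1) ^ 2 ≤ (x 0 ^ 2 + x 1 ^ 2) * (y 0 ^ 2 + y 1 ^ 2) := by
    nlinarith [sq_nonneg (x 0 * y 1 - x 1 * y 0)]
  have h4 : (x 0 ^ 2 + x 1 ^ 2) * (y 0 ^ 2 + y 1 ^ 2) ≤ x 2 ^ 2 * (y 0 ^ 2 + y 1 ^ 2) := by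
    gcongr; linarith
  have h5 : x 2 ^ 2 * (y 0 ^ 2 + y 1 ^ 2) < x 2 ^ 2 * y 2 ^ 2 := by
    gcongr; linarith
  nlinarith

/-! ### Hyperbolic translations along the geodesic with a given unit normal -/

/-- The translation by `L` along the geodesic orthogonal to `m`. -/
def boost (L : ℝ) (m x : Fin 3 → ℝ) : Fin 3 → ℝ :=
  Real.cosh L • x + ((1 - Real.cosh L) * lor x m) • m + Real.sinh L • lcross m x

theorem lor_boost_self {L : ℝ} {m : Fin 3 → ℝ} (hm : lor m m = 1) (x : Fin 3 → ℝ) :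
    lor (boost L m x) m = lor x m := by
  simp only [boost, lor_add_left, lor_smul_left, hm, lor_lcross_self_left]; ring

theorem boost_self {L : ℝ} {m : Fin 3 → ℝ} (hm : lor m m = 1) : boost L m m = m := by
  rw [boost, lcross_self, hm, smul_zero, add_zero, ← add_smul]
  simp

/-- For unit spacelike $m$ the operator $m\times$ is skew-adjoint and its square is the projection
to $m^\perp$. Thus `boost L m` is the exponential of $L\,(m\times)$, an isometry. -/
theorem lor_boost_boost {L : ℝ} {m : Fin 3 → ℝ} (hm : lor m m = 1) (x y : Fin 3 → ℝ) :
    lor (boost L m x) (boost L m y) = lor x y := by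
  have h := Real.cosh_sq L
  simp only [boost, lor_add_left, lor_smul_left, lor_add_right, lor_smul_right, hm,
    lor_lcross_lcross, lor_lcross_self_left]
  rw [lor_comm m y, lor_comm m (lcross m y), lor_lcross_self_left, lor_comm x (lcross m y),
    lor_lcross_left_comm m y x]
  linear_combination (lor x y - lor x m * lor y m) * h

/-- Inverting by reversing the normal rather than $L$ keeps the inverse in the family of boosts with
the same $L$. -/
theorem boost_neg_boost {L : ℝ} {m : Fin 3 → ℝ} (hm : lor m m = 1) (x : Fin 3 → ℝ) :
    boost L (-m) (boost L m x) = x := by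
  have h := Real.cosh_sq L
  have e : boost L (-m) (boost L m x) = Real.cosh L • boost L m x +
      ((1 - Real.cosh L) * lor x m) • m - Real.sinh L • lcross m (boost L m x) := by
    rw [boost, lor_neg_right, lor_boost_self hm, lcross_neg_left]
    module
  have e2 : lcross m (boost L m x) = Real.cosh L • lcross m x + Real.sinh L • (x - lor x m • m) := by
    simp only [boost, lcross_add_right, lcross_smul_right, lcross_self, lcross_lcross_right, hm]
    module
  rw [e, e2, boost]
  ext i
  simp only [Pi.add_apply, Pi.sub_apply, Pi.smul_apply, smul_eq_mul]
  linear_combination (x i - lor x m * m i) * h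

/-- The matrix of `boost L m`. -/
def boostMat (L : ℝ) (m : Fin 3 → ℝ) : Matrix (Fin 3) (Fin 3) ℝ :=
  Real.cosh L • (1 : Matrix (Fin 3) (Fin 3) ℝ)
    + (1 - Real.cosh L) • Matrix.of ![![m 0 * m 0, m 0 * m 1, -(m 0 * m 2)],
        ![m 1 * m 0, m 1 * m 1, -(m 1 * m 2)], ![m 2 * m 0, m 2 * m 1, -(m 2 * m 2)]]
    + Real.sinh L • Matrix.of ![![0, -m 2, m 1], ![m 2, 0, -m 0], ![m 1, -m 0, 0]]

theorem boostMat_mulVec (L : ℝ) (m x : Fin 3 → ℝ) : boostMat L m *ᵥ x = boost L m x := by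
  rw [boostMat, Matrix.add_mulVec, Matrix.add_mulVec, Matrix.smul_mulVec, Matrix.smul_mulVec,
    Matrix.smul_mulVec, Matrix.one_mulVec, boost]
  apply ext_three <;>
  simp [dotProduct, Fin.sum_univ_three, lor, lcross, Matrix.vecHead, Matrix.vecTail] <;> ring

theorem lor_eq_dotProduct (x y : Fin 3 → ℝ) : lor x y = x ⬝ᵥ (J ℝ *ᵥ y) := by
  simp [lor, J, dotProduct, Fin.sum_univ_three, Matrix.mulVec_diagonal]; ring

theorem lor_mulVec_mulVec {N : Matrix (Fin 3) (Fin 3) ℝ} (hN : Nᵀ * J ℝ * N = J ℝ)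
    (x y : Fin 3 → ℝ) : lor (N *ᵥ x) (N *ᵥ y) = lor x y := by
  conv_rhs => rw [lor_eq_dotProduct, ← hN]
  rw [lor_eq_dotProduct, Matrix.dotProduct_mulVec, Matrix.vecMul_mulVec,
    ← Matrix.dotProduct_mulVec, Matrix.mulVec_mulVec]

theorem transpose_mul_J_mul {N : Matrix (Fin 3) (Fin 3) ℝ}
    (hN : ∀ x y, lor (N *ᵥ x) (N *ᵥ y) = lor x y) : Nᵀ * J ℝ * N = J ℝ := by
  have h : ∀ x y : Fin 3 → ℝ, x ⬝ᵥ ((Nᵀ * J ℝ * N) *ᵥ y) = x ⬝ᵥ (J ℝ *ᵥ y) := by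
    intro x y
    rw [← lor_eq_dotProduct, ← hN x y, lor_eq_dotProduct, Matrix.dotProduct_mulVec x,
      Matrix.dotProduct_mulVec (N *ᵥ x), ← Matrix.vecMul_transpose, Matrix.vecMul_vecMul,
      Matrix.dotProduct_mulVec, Matrix.vecMul_vecMul]
  ext i j
  simpa using h (Pi.single i 1) (Pi.single j 1)

theorem mat_ext {M N : Matrix (Fin 3) (Fin 3) ℝ} (h : ∀ x, M *ᵥ x = N *ᵥ x) : M = N :=
  Matrix.toLin'.injective (LinearMap.ext h)

theorem boostMat_neg_mul {L : ℝ} {m : Fin 3 → ℝ} (hm : lor m m = 1) :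
    boostMat L (-m) * boostMat L m = 1 := by
  apply mat_ext
  intro x
  rw [← Matrix.mulVec_mulVec, boostMat_mulVec, boostMat_mulVec, boost_neg_boost hm,
    Matrix.one_mulVec]

theorem boostMat_mul_neg {L : ℝ} {m : Fin 3 → ℝ} (hm : lor m m = 1) :
    boostMat L m * boostMat L (-m) = 1 := by
  simpa using boostMat_neg_mul (L := L) (m := -m) (by rw [lor_neg_left, lor_neg_right, neg_neg, hm])

/-- The hyperbolic element of `O(2,1)` translating by `L` along the geodesic orthogonal to `m`. -/
def boostO (L : ℝ) (m : {m : Fin 3 → ℝ // lor m m = 1}) : O21 :=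
  ⟨⟨boostMat L m, boostMat L (-m), boostMat_mul_neg m.2, boostMat_neg_mul m.2⟩,
    transpose_mul_J_mul fun x y => by
      rw [boostMat_mulVec, boostMat_mulVec, lor_boost_boost m.2]⟩

/-- The matrix of an element of `O(2,1)`. -/
abbrev omat (N : O21) : Matrix (Fin 3) (Fin 3) ℝ := ((N : GL (Fin 3) ℝ) : Matrix (Fin 3) (Fin 3) ℝ)

theorem omat_mul (N N' : O21) : omat (N * N') = omat N * omat N' := rfl

theorem omat_inv_mulVec (N : O21) (x : Fin 3 → ℝ) : omat N⁻¹ *ᵥ (omat N *ᵥ x) = x := by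
  rw [Matrix.mulVec_mulVec, ← omat_mul, inv_mul_cancel]
  exact Matrix.one_mulVec x

theorem omat_mulVec_inv (N : O21) (x : Fin 3 → ℝ) : omat N *ᵥ (omat N⁻¹ *ᵥ x) = x := by
  rw [Matrix.mulVec_mulVec, ← omat_mul, mul_inv_cancel]
  exact Matrix.one_mulVec x

theorem lor_omat (N : O21) (x y : Fin 3 → ℝ) : lor (omat N *ᵥ x) (omat N *ᵥ y) = lor x y :=
  lor_mulVec_mulVec N.2 x y

theorem O21_ext {N N' : O21} (h : ∀ x, omat N *ᵥ x = omat N' *ᵥ x) : N = N' := by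
  apply Subtype.ext
  exact Units.ext (mat_ext h)

theorem boostO_mulVec (L : ℝ) (m : {m : Fin 3 → ℝ // lor m m = 1}) (x : Fin 3 → ℝ) :
    omat (boostO L m) *ᵥ x = boost L m x := boostMat_mulVec L m x

theorem det_omat (N : O21) : (omat N).det = 1 ∨ (omat N).det = -1 := by
  have h : (omat N)ᵀ * J ℝ * omat N = J ℝ := N.2
  have := congrArg Matrix.det h
  simp only [Matrix.det_mul, Matrix.det_transpose, J, Matrix.det_diagonal, Fin.prod_univ_three] at this
  simp at this
  exact mul_self_eq_one_iff.1 this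

theorem lor_lcross_eq_det (x y z : Fin 3 → ℝ) :
    lor (lcross x y) z = (Matrix.of ![x, y, z]).det := by
  simp [Matrix.det_fin_three, lor, lcross]; ring

/-- Pairing with a third vector turns the cross product into a determinant, which an isometry
multiplies by its own determinant. -/
theorem lcross_omat (N : O21) (x y : Fin 3 → ℝ) :
    lcross (omat N *ᵥ x) (omat N *ᵥ y) = (omat N).det • (omat N *ᵥ lcross x y) := by
  apply eq_of_lor_eq
  intro z
  rw [← omat_mulVec_inv N z, lor_smul_left, lor_omat, lor_lcross_eq_det, lor_lcross_eq_det]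
  generalize omat N⁻¹ *ᵥ z = z
  have e : Matrix.of ![omat N *ᵥ x, omat N *ᵥ y, omat N *ᵥ z]
      = Matrix.of ![x, y, z] * (omat N)ᵀ := by
    ext i j
    fin_cases i <;> simp [Matrix.mul_apply, Matrix.mulVec, dotProduct, Fin.sum_univ_three] <;> ring
  rw [e, Matrix.det_mul, Matrix.det_transpose, mul_comm]

/-- Only the cross-product term is odd in the normal, so the sign of the determinant can be absorbed
there. -/
theorem omat_boost (L : ℝ) (N : O21) (m x : Fin 3 → ℝ) :
    omat N *ᵥ boost L m x = boost L ((omat N).det • (omat N *ᵥ m)) (omat N *ᵥ x) := by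
  simp only [boost, Matrix.mulVec_add, Matrix.mulVec_smul, lcross_smul_left, lcross_omat,
    lor_smul_right, lor_omat]
  rcases det_omat N with h | h <;> rw [h] <;> module

/-- The image of a unit spacelike vector, as a pseudovector. -/
def conjNormal (N : O21) (m : {m : Fin 3 → ℝ // lor m m = 1}) : {m : Fin 3 → ℝ // lor m m = 1} :=
  ⟨(omat N).det • (omat N *ᵥ m.1), by
    rw [lor_smul_left, lor_smul_right, lor_omat, m.2]
    rcases det_omat N with h | h <;> rw [h] <;> norm_num⟩

theorem conj_boostO (L : ℝ) (N : O21) (m : {m : Fin 3 → ℝ // lor m m = 1}) :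
    N * boostO L m * N⁻¹ = boostO L (conjNormal N m) := by
  apply O21_ext
  intro x
  rw [omat_mul, omat_mul, ← Matrix.mulVec_mulVec, ← Matrix.mulVec_mulVec, boostO_mulVec,
    omat_boost, omat_mulVec_inv, boostO_mulVec]
  rfl

/-! ### Real points and geodesics -/

/-- The inclusion of `ℝ³` in `ℂ³`. -/
def cvec (u : Fin 3 → ℝ) : V3 := fun i => (u i : ℂ)

theorem herm_cvec (u v : Fin 3 → ℝ) : herm (cvec u) (cvec v) = (lor u v : ℂ) := by
  simp only [herm_eq, cvec, lor, ← starRingEnd_apply, Complex.conj_ofReal]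
  push_cast; ring

theorem cvec_ne_zero {u : Fin 3 → ℝ} (hu : u ≠ 0) : cvec u ≠ 0 := fun h =>
  hu (funext fun i => by simpa [cvec] using congrFun h i)

theorem ne_zero_of_lor_neg {u : Fin 3 → ℝ} (hu : lor u u < 0) : u ≠ 0 := by
  rintro rfl
  simp [lor] at hu

/-- The point of `H²_ℝ` spanned by a timelike vector. -/
def pt (u : Fin 3 → ℝ) (hu : lor u u < 0) : CH2 :=
  ⟨Projectivization.mk ℂ (cvec u) (cvec_ne_zero (ne_zero_of_lor_neg hu)),
    (isNeg_mk _ _).2 (by rw [herm_cvec, Complex.ofReal_re]; exact hu)⟩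

theorem pt_congr {u v : Fin 3 → ℝ} (h : u = v) (hu : lor u u < 0) (hv : lor v v < 0) :
    pt u hu = pt v hv := by
  subst h; rfl

theorem pt_smul {u : Fin 3 → ℝ} {a : ℝ} (hu : lor u u < 0)
    (h : lor (a • u) (a • u) < 0) : pt (a • u) h = pt u hu := by
  refine Subtype.ext ((Projectivization.mk_eq_mk_iff' ℂ _ _ _ _).2 ⟨(a : ℂ), ?_⟩)
  ext i
  simp [cvec]

theorem chDist_pt {u v : Fin 3 → ℝ} (hu : lor u u < 0) (hv : lor v v < 0) :
    chDist (pt u hu) (pt v hv) = 2 * Real.arcosh (|lor u v| / √(lor u u * lor v v)) := by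
  rw [pt, pt, chDist_mk, herm_cvec, herm_cvec, herm_cvec]
  simp

theorem cosh_chDist_pt {u v : Fin 3 → ℝ} (hu : lor u u < 0) (hv : lor v v < 0) :
    Real.cosh (chDist (pt u hu) (pt v hv) / 2) = |lor u v| / √(lor u u * lor v v) := by
  rw [chDist_pt, mul_div_cancel_left₀ _ two_ne_zero, Real.cosh_arcosh]
  have h : 0 < lor u u * lor v v := mul_pos_of_neg_of_neg hu hv
  rw [one_le_div (Real.sqrt_pos.2 h)]
  exact Real.sqrt_le_iff.2 ⟨abs_nonneg _, by rw [sq_abs]; exact lor_mul_lor_le hu v⟩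

theorem cosh_chDist_pt_unit {u v : Fin 3 → ℝ} (hu : lor u u < 0) (hv : lor v v < 0)
    (hu1 : lor u u = -1) (hv1 : lor v v = -1) :
    Real.cosh (chDist (pt u hu) (pt v hv) / 2) = |lor u v| := by
  rw [cosh_chDist_pt, hu1, hv1]; norm_num

theorem exists_forward_rep {x : CH2} (hx : x ∈ RH2) : ∃ (u : Fin 3 → ℝ) (hu : lor u u < 0),
    x = pt u hu ∧ lor u u = -1 ∧ 0 < u 2 := by
  obtain ⟨v, hv, hxv⟩ := hx
  have hneg : lor v v < 0 := by
    have := x.2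
    rw [hxv, isNeg_mk] at this
    change (herm (cvec v) (cvec v)).re < 0 at this
    rwa [herm_cvec, Complex.ofReal_re] at this
  have hs : 0 < √(-lor v v) := Real.sqrt_pos.2 (by linarith)
  have hs2 : √(-lor v v) ^ 2 = -lor v v := Real.sq_sqrt (by linarith)
  have hv2 : v 2 ≠ 0 := by
    intro h0
    simp only [lor, h0] at hneg
    nlinarith [sq_nonneg (v 0), sq_nonneg (v 1)]
  have key : ∀ a : ℝ, a ≠ 0 → a ^ 2 * lor v v = -1 → 0 < a * v 2 →
      ∃ (u : Fin 3 → ℝ) (hu : lor u u < 0), x = pt u hu ∧ lor u u = -1 ∧ 0 < u 2 := by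
    intro a ha h1 h2
    have h1' : lor (a • v) (a • v) = -1 := by
      rw [lor_smul_left, lor_smul_right, ← h1]; ring
    refine ⟨a • v, by rw [h1']; norm_num, ?_, h1', by simpa using h2⟩
    rw [pt_smul hneg]
    exact Subtype.ext hxv
  have hinv : (√(-lor v v))⁻¹ ^ 2 * lor v v = -1 := by
    rw [inv_pow, hs2, inv_neg, neg_mul, inv_mul_cancel₀ hneg.ne]
  rcases lt_or_gt_of_ne hv2 with h | h
  · refine key (-(√(-lor v v))⁻¹) (by simpa using hs.ne') (by rw [neg_sq, hinv]) ?_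
    rw [neg_mul]
    have := mul_neg_of_pos_of_neg (inv_pos.2 hs) h
    linarith
  · exact key (√(-lor v v))⁻¹ (inv_ne_zero hs.ne') hinv (mul_pos (inv_pos.2 hs) h)

/-- A point of `H²_ℝ` has one forward unit representative only. -/
theorem eq_of_pt_eq {u v : Fin 3 → ℝ} (hu : lor u u < 0) (hv : lor v v < 0) (hu1 : lor u u = -1)
    (hv1 : lor v v = -1) (hu2 : 0 < u 2) (hv2 : 0 < v 2) (h : pt u hu = pt v hv) : u = v := by
  have h' := congrArg Subtype.val h
  obtain ⟨a, ha⟩ := (Projectivization.mk_eq_mk_iff' ℂ _ _ _ _).1 h'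
  have e : ∀ i, a * (v i : ℂ) = (u i : ℂ) := fun i => by simpa [cvec] using congrFun ha i
  have hv2' : (v 2 : ℂ) ≠ 0 := by exact_mod_cast hv2.ne'
  have ea : a = ((u 2 / v 2 : ℝ) : ℂ) := by
    push_cast; rw [← e 2]; field_simp
  set r := u 2 / v 2 with hr
  have hr0 : 0 < r := div_pos hu2 hv2
  have e' : u = r • v := by
    ext i
    have := e i
    rw [ea] at this
    simp only [Pi.smul_apply, smul_eq_mul]
    exact_mod_cast this.symm
  rw [e', lor_smul_left, lor_smul_right, hv1] at hu1
  have : r = 1 := by nlinarith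
  rw [e', this, one_smul]

/-- The action of `O(2,1)` on the complex hyperbolic plane. -/
def toPU : O21 →* PU21 := (QuotientGroup.mk' scalars).comp complexify

theorem toPU_smul_pt (N : O21) (u : Fin 3 → ℝ) (hu : lor u u < 0) :
    toPU N • pt u hu = pt (omat N *ᵥ u) (by rw [lor_omat]; exact hu) := by
  refine Subtype.ext ?_
  change (QuotientGroup.mk (complexify N) : PU21) • Projectivization.mk ℂ (cvec u) _ = _
  rw [mk_smul, U21_smul_mk]
  refine (Projectivization.mk_eq_mk_iff' ℂ _ _ _ _).2 ⟨1, ?_⟩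
  rw [one_smul, U21_smul_def]
  change _ = (omat N).map (algebraMap ℝ ℂ) *ᵥ cvec u
  ext i
  simp [cvec, Matrix.mulVec, dotProduct]

theorem exists_omat_of_toPU_eq {N N' : O21} (h : toPU N = toPU N') :
    ∃ c : ℂ, ∀ i j, (omat N' i j : ℂ) = c * omat N i j := by
  obtain ⟨c, hc⟩ := QuotientGroup.eq.1 h
  refine ⟨c, fun i j => ?_⟩
  have e : complexify N' = complexify N * ((complexify N)⁻¹ * complexify N') := by group
  have e2 : (omat N').map (algebraMap ℝ ℂ)
      = (omat N).map (algebraMap ℝ ℂ) * (c • (1 : Matrix (Fin 3) (Fin 3) ℂ)) := by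
    rw [← hc]
    exact congrArg (fun M : U21 => ((M : GL (Fin 3) ℂ) : Matrix (Fin 3) (Fin 3) ℂ)) e
  have := congrFun (congrFun e2 i) j
  simpa using this

theorem trace_boostMat {L : ℝ} {m : Fin 3 → ℝ} (hm : lor m m = 1) :
    boostMat L m 0 0 + boostMat L m 1 1 + boostMat L m 2 2 = 1 + 2 * Real.cosh L := by
  simp only [lor] at hm
  simp [boostMat]
  linear_combination (1 - Real.cosh L) * hm

/-- Equality in $PU(2,1)$ leaves a scalar. Both matrices have trace $1+2\cosh L\ne0$, so the scalar
is $1$, and opposite off-diagonal entries then determine $\sinh L\cdot m$. -/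
theorem toPU_boostO_injective {L : ℝ} (hL : 0 < L) {m m' : {m : Fin 3 → ℝ // lor m m = 1}}
    (h : toPU (boostO L m) = toPU (boostO L m')) : m = m' := by
  obtain ⟨c, hc⟩ := exists_omat_of_toPU_eq h
  change ∀ i j, (boostMat L m' i j : ℂ) = c * boostMat L m i j at hc
  have t := trace_boostMat (L := L) m.2
  have t' := trace_boostMat (L := L) m'.2
  have hpos : (1 + 2 * Real.cosh L) ≠ 0 := by positivity
  have hc1 : c = 1 := by
    have e1 : ((1 + 2 * Real.cosh L : ℝ) : ℂ) = c * ((1 + 2 * Real.cosh L : ℝ) : ℂ) := by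
      nth_rw 1 [← t']
      rw [← t]
      push_cast
      rw [hc, hc, hc]; ring
    have : ((1 + 2 * Real.cosh L : ℝ) : ℂ) ≠ 0 := by exact_mod_cast hpos
    exact (mul_right_cancel₀ this (by rw [one_mul]; exact e1)).symm
  have e : ∀ i j, boostMat L m' i j = boostMat L m i j := fun i j => by
    have := hc i j
    rw [hc1, one_mul] at this
    exact_mod_cast this
  have hs : Real.sinh L ≠ 0 := (Real.sinh_pos_iff.2 hL).ne'
  have e01 := e 0 1
  have e10 := e 1 0
  have e02 := e 0 2
  have e20 := e 2 0
  have e12 := e 1 2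
  have e21 := e 2 1
  simp [boostMat] at e01 e10 e02 e20 e12 e21
  apply Subtype.ext
  apply ext_three <;> apply mul_left_cancel₀ hs <;> linarith

/-- The geodesic of `H²_ℝ` with normal vector `m`. -/
def geod (m : Fin 3 → ℝ) : Set CH2 := 
  {x | ∃ (u : Fin 3 → ℝ) (hu : lor u u < 0), x = pt u hu ∧ lor u m = 0}

theorem smul_mem_geod (N : O21) {m : Fin 3 → ℝ} {x : CH2} (hx : x ∈ geod m) :
    toPU N • x ∈ geod (omat N *ᵥ m) := by
  obtain ⟨u, hu, rfl, h⟩ := hx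
  exact ⟨_, _, toPU_smul_pt N u hu, by rw [lor_omat, h]⟩

theorem smul_geod (N : O21) (m : Fin 3 → ℝ) : toPU N • geod m = geod (omat N *ᵥ m) := by
  ext x
  rw [Set.mem_smul_set_iff_inv_smul_mem]
  constructor
  · intro h
    simpa using smul_mem_geod N h
  · intro h
    have := smul_mem_geod N⁻¹ h
    rwa [omat_inv_mulVec, map_inv] at this

theorem geod_smul {a : ℝ} (ha : a ≠ 0) (m : Fin 3 → ℝ) : geod (a • m) = geod m := by
  simp [geod, lor_smul_right, ha]

theorem geod_conjNormal (N : O21) (m : {m : Fin 3 → ℝ // lor m m = 1}) :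
    geod (conjNormal N m) = toPU N • geod m := by
  rw [smul_geod]
  refine geod_smul ?_ _
  rcases det_omat N with h | h <;> rw [h] <;> norm_num

/-- The cross product of the normals has square $\langle m,m'\rangle^2-1<0$, so it spans a common
point. -/
theorem geod_inter_nonempty {m m' : Fin 3 → ℝ} (hm : lor m m = 1) (hm' : lor m' m' = 1)
    (h : |lor m m'| < 1) : (geod m ∩ geod m').Nonempty := by
  have hu : lor (lcross m m') (lcross m m') < 0 := by
    rw [lor_lcross_lcross, hm, hm', lor_comm m' m]
    have := (sq_lt_one_iff_abs_lt_one (lor m m')).2 h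
    nlinarith
  exact ⟨pt _ hu, ⟨_, hu, rfl, lor_lcross_self_left _ _⟩, ⟨_, hu, rfl, lor_lcross_self_right _ _⟩⟩

/-- Apply the reversed Cauchy–Schwarz inequality to $u$ with $v-\langle v,m\rangle m$, and to $v$
with $m-\langle m,m'\rangle m'$, then eliminate $\langle v,m\rangle$. -/
theorem abs_lor_le_cosh {m m' : Fin 3 → ℝ} (hm : lor m m = 1) (hm' : lor m' m' = 1) {x y : CH2}
    (hx : x ∈ geod m) (hy : y ∈ geod m') : |lor m m'| ≤ Real.cosh (chDist x y / 2) := by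
  obtain ⟨u, hu, rfl, hum⟩ := hx
  obtain ⟨v, hv, rfl, hvm⟩ := hy
  have hpos : 0 < lor u u * lor v v := mul_pos_of_neg_of_neg hu hv
  rw [cosh_chDist_pt, le_div_iff₀ (Real.sqrt_pos.2 hpos)]
  refine abs_le_of_sq_le_sq' ?_ (abs_nonneg _) |>.2
  rw [mul_pow, Real.sq_sqrt hpos.le, sq_abs, sq_abs]
  have h1 := lor_mul_lor_le hu (v - lor v m • m)
  have h2 := lor_mul_lor_le hv (m - lor m m' • m')
  simp only [lor_sub_left, lor_sub_right, lor_smul_left, lor_smul_right, hm, hm', hum, hvm,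
    lor_comm m v, lor_comm m' m] at h1 h2
  nlinarith

/-! ### Parametrized geodesics and hyperbolic elements -/

/-- The point at time `t` of the geodesic of curvature `-1/4` through `v` with direction `w`. -/
def line (v w : Fin 3 → ℝ) (t : ℝ) : Fin 3 → ℝ := Real.cosh (t / 2) • v + Real.sinh (t / 2) • w

theorem lcross_frame_left {v w : Fin 3 → ℝ} (hv : lor v v = -1) (hvw : lor v w = 0) :
    lcross (lcross v w) v = w := by
  rw [lcross_lcross_left, lor_comm w v, hv, hvw]; module

theorem lcross_frame_right {v w : Fin 3 → ℝ} (hw : lor w w = 1) (hvw : lor v w = 0) :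
    lcross (lcross v w) w = v := by
  rw [lcross_lcross_left, hw, hvw]; module

theorem lor_frame_normal {v w : Fin 3 → ℝ} (hv : lor v v = -1) (hw : lor w w = 1)
    (hvw : lor v w = 0) : lor (lcross v w) (lcross v w) = 1 := by
  rw [lor_lcross_lcross, lor_comm w v, hv, hw, hvw]; norm_num

theorem frame_expansion {v w : Fin 3 → ℝ} (hv : lor v v = -1) (hw : lor w w = 1)
    (hvw : lor v w = 0) (x : Fin 3 → ℝ) :
    x = (-lor x v) • v + lor x w • w + lor x (lcross v w) • lcross v w := by
  have h1 := lcross_lcross_right (lcross v w) x (lcross v w)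
  rw [lor_frame_normal hv hw hvw, lcross_lcross_left v w x, sub_eq_add_neg, ← neg_smul,
    lcross_add_right, lcross_smul_right, lcross_smul_right, lcross_frame_left hv hvw,
    lcross_frame_right hw hvw, one_smul, lor_comm w x, lor_comm v x] at h1
  rw [eq_sub_iff_add_eq] at h1
  nth_rw 1 [← h1]
  module

theorem lor_line {v w : Fin 3 → ℝ} (hv : lor v v = -1) (hw : lor w w = 1)
    (hvw : lor v w = 0) (t : ℝ) : lor (line v w t) (line v w t) = -1 := by
  simp only [line, lor_add_left, lor_add_right, lor_smul_left, lor_smul_right, hv, hw, hvw,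
    lor_comm w v]
  linear_combination -Real.cosh_sq (t / 2)

theorem lor_line_normal (v w : Fin 3 → ℝ) (t : ℝ) : lor (line v w t) (lcross v w) = 0 := by
  simp only [line, lor_add_left, lor_smul_left]
  rw [lor_comm v, lor_comm w, lor_lcross_self_left, lor_lcross_self_right]; ring

/-- The forward unit representatives have products $-\cosh((s-t)/2)$. This fixes their coordinates
along $v$ and $w$, and the unit norm kills the normal component. -/
theorem exists_line {c : ℝ → CH2} (hc : ∀ t, c t ∈ RH2)
    (hd : ∀ s t, chDist (c s) (c t) = |s - t|) :
    ∃ v w : Fin 3 → ℝ, lor v v = -1 ∧ lor w w = 1 ∧ lor v w = 0 ∧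
      ∀ t, 0 < line v w t 2 ∧ ∃ h, c t = pt (line v w t) h := by
  choose u hu hcu h1 h2 using fun t => exists_forward_rep (hc t)
  have hB : ∀ s t, lor (u s) (u t) = -Real.cosh ((s - t) / 2) := by
    intro s t
    have e := cosh_chDist_pt_unit (hu s) (hu t) (h1 s) (h1 t)
    rw [← hcu, ← hcu, hd, abs_of_neg (lor_neg_of_forward (hu s) (hu t) (h2 s) (h2 t)),
      show |s - t| / 2 = |(s - t) / 2| by rw [abs_div, abs_two], Real.cosh_abs] at e
    linarith
  have hs : Real.sinh 1 ≠ 0 := (Real.sinh_pos_iff.2 one_pos).ne'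
  have hcs := Real.cosh_sq 1
  set v := u 0 with hv
  -- The direction is read off at time $2$, where the boost parameter $t/2$ is $1$.
  set w := (Real.sinh 1)⁻¹ • (u 2 - Real.cosh 1 • v) with hw
  have h20 : lor (u 2) v = -Real.cosh 1 := by rw [hv, hB]; norm_num
  have hvv : lor v v = -1 := h1 0
  have hww : lor w w = 1 := by
    simp only [hw, lor_smul_left, lor_smul_right, lor_sub_left, lor_sub_right, h1, h20,
      lor_comm v (u 2), hvv]
    field_simp
    linarith
  have hvw : lor v w = 0 := by
    simp only [hw, lor_smul_right, lor_sub_right, lor_comm v (u 2), h20, hvv]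
    ring
  have key : ∀ t, u t = line v w t := by
    intro t
    have e1 : lor (u t) v = -Real.cosh (t / 2) := by rw [hv, hB, sub_zero]
    have e2 : lor (u t) w = Real.sinh (t / 2) := by
      rw [hw, lor_smul_right, lor_sub_right, lor_smul_right, e1, hB,
        show (t - 2) / 2 = t / 2 - 1 by ring, Real.cosh_sub]
      field_simp
      ring
    have ex := frame_expansion hvv hww hvw (u t)
    rw [e1, e2, neg_neg] at ex
    change u t = line v w t + _ at ex
    have hn := h1 t
    generalize lor (u t) (lcross v w) = a at ex
    rw [ex] at hn
    simp only [lor_add_left, lor_add_right, lor_smul_left, lor_smul_right, lor_line hvv hww hvw,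
      lor_comm _ (line v w t), lor_line_normal, lor_frame_normal hvv hww hvw] at hn
    have h0 : a = 0 := by nlinarith
    rw [h0, zero_smul, add_zero] at ex
    exact ex
  refine ⟨v, w, hvv, hww, hvw, fun t => ⟨key t ▸ h2 t, key t ▸ hu t, ?_⟩⟩
  rw [hcu t]
  exact pt_congr (key t) _ _

theorem range_line_eq_geod {c : ℝ → CH2} {v w : Fin 3 → ℝ} (hv : lor v v = -1) (hw : lor w w = 1)
    (hvw : lor v w = 0) (hc : ∀ t, ∃ h, c t = pt (line v w t) h) :
    Set.range c = geod (lcross v w) := by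
  ext x
  constructor
  · rintro ⟨t, rfl⟩
    obtain ⟨h, e⟩ := hc t
    exact ⟨_, h, e, lor_line_normal v w t⟩
  · rintro ⟨u, hu, rfl, hun⟩
    have ex := frame_expansion hv hw hvw u
    rw [hun, zero_smul, add_zero] at ex
    generalize -lor u v = a at ex
    generalize lor u w = b at ex
    have hab : b ^ 2 < a ^ 2 := by
      rw [ex] at hu
      simp only [lor_add_left, lor_add_right, lor_smul_left, lor_smul_right, hv, hw, hvw,
        lor_comm w v] at hu
      linarith
    -- The sign of $r$ is that of $a$, so that $a/r$ can be a hyperbolic cosine.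
    obtain ⟨r, hr0, hr2, har⟩ : ∃ r : ℝ, r ≠ 0 ∧ r ^ 2 = a ^ 2 - b ^ 2 ∧ 0 ≤ a / r := by
      have hs : 0 < √(a ^ 2 - b ^ 2) := Real.sqrt_pos.2 (by linarith)
      have hs2 : √(a ^ 2 - b ^ 2) ^ 2 = a ^ 2 - b ^ 2 := Real.sq_sqrt (by linarith)
      rcases le_total 0 a with h | h
      · exact ⟨_, hs.ne', hs2, by positivity⟩
      · exact ⟨-√(a ^ 2 - b ^ 2), by simpa using hs.ne', by rw [neg_sq, hs2],
          div_nonneg_of_nonpos h (by linarith)⟩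
    refine ⟨2 * Real.arsinh (b / r), ?_⟩
    have hch : Real.cosh (Real.arsinh (b / r)) = a / r := by
      rw [Real.cosh_arsinh, ← Real.sqrt_sq har]
      congr 1
      field_simp
      linarith
    have e : u = r • line v w (2 * Real.arsinh (b / r)) := by
      rw [line, mul_div_cancel_left₀ _ two_ne_zero, hch, Real.sinh_arsinh, smul_add, smul_smul,
        smul_smul, mul_div_cancel₀ _ hr0, mul_div_cancel₀ _ hr0, ← ex]
    obtain ⟨h, hct⟩ := hc (2 * Real.arsinh (b / r))
    rw [hct, pt_congr e hu (e ▸ hu), pt_smul h]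

/-- The image of the vertical vector is forward because the last diagonal entry is positive. Its
product with the image of $u$ is still $-u_2<0$, so that image cannot be backward. -/
theorem forward_omat {N : O21} (hN : 0 < omat N 2 2) {u : Fin 3 → ℝ} (hu : lor u u < 0)
    (hu2 : 0 < u 2) : 0 < (omat N *ᵥ u) 2 := by
  set e : Fin 3 → ℝ := ![0, 0, 1] with he
  have hNe : (omat N *ᵥ e) 2 = omat N 2 2 := by
    simp [he, Matrix.mulVec, dotProduct, Fin.sum_univ_three]
  have hee : lor e e < 0 := by simp [he, lor]
  have heu : lor e u = -u 2 := by simp [he, lor]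
  have h1 : lor (omat N *ᵥ e) (omat N *ᵥ e) < 0 := by rw [lor_omat]; exact hee
  have h2 : lor (omat N *ᵥ u) (omat N *ᵥ u) < 0 := by rw [lor_omat]; exact hu
  by_contra hcon
  rcases (not_lt.1 hcon).lt_or_eq with h | h
  · have := lor_neg_of_forward (y := -(omat N *ᵥ u)) h1
      (by rw [lor_neg_left, lor_neg_right, neg_neg]; exact h2) (by rw [hNe]; exact hN)
      (by simpa using h)
    rw [lor_neg_right, lor_omat, heu] at this
    linarith
  · simp only [lor, h] at h2
    nlinarith [sq_nonneg ((omat N *ᵥ u) 0), sq_nonneg ((omat N *ᵥ u) 1)]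

theorem boost_frame_left (L : ℝ) {v w : Fin 3 → ℝ} (hv : lor v v = -1) (hvw : lor v w = 0) :
    boost L (lcross v w) v = Real.cosh L • v + Real.sinh L • w := by
  rw [boost, lcross_frame_left hv hvw, lor_comm v, lor_lcross_self_left]; module

theorem boost_frame_right (L : ℝ) {v w : Fin 3 → ℝ} (hw : lor w w = 1) (hvw : lor v w = 0) :
    boost L (lcross v w) w = Real.sinh L • v + Real.cosh L • w := by
  rw [boost, lcross_frame_right hw hvw, lor_comm w, lor_lcross_self_right]; module

theorem lcross_rotate (a b : ℝ) (v w : Fin 3 → ℝ) :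
    lcross (a • v + b • w) (b • v + a • w) = (a ^ 2 - b ^ 2) • lcross v w := by
  apply ext_three <;> simp only [lcross_apply_zero, lcross_apply_one, lcross_apply_two,
    Pi.smul_apply, Pi.add_apply, smul_eq_mul] <;> ring

/-- A hyperbolic element is a translation of the Lorentz space, and its axis is the orthogonal
geodesic of the normal vector. -/
theorem exists_boost_of_isHyperbolicWith {γ : PU21} {A : Set CH2} {ℓ : ℝ}
    (hA : IsHyperbolicWith γ A ℓ) : ∃ (v w : Fin 3 → ℝ) (n : {m : Fin 3 → ℝ // lor m m = 1}),
      lor v v = -1 ∧ lor w w = 1 ∧ lor v w = 0 ∧ n.1 = lcross v w ∧ A = geod n ∧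
      γ = toPU (boostO (ℓ / 2) n) ∧ (omat (boostO (ℓ / 2) n)).det = 1 := by
  obtain ⟨⟨M, rfl, hdet, hM⟩, -, c, hcA, hAR, hd, htr⟩ := hA
  obtain ⟨v, w, hv, hw, hvw, hline⟩ :=
    exists_line (fun t => hAR (hcA ▸ Set.mem_range_self t)) hd
  refine ⟨v, w, ⟨lcross v w, lor_frame_normal hv hw hvw⟩, hv, hw, hvw, rfl,
    hcA ▸ range_line_eq_geod hv hw hvw fun t => (hline t).2, ?_⟩
  have hMl : ∀ t, omat M *ᵥ line v w t = line v w (t + ℓ) := by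
    intro t
    obtain ⟨h0, h1, h2⟩ := hline t
    obtain ⟨k0, k1, k2⟩ := hline (t + ℓ)
    have e := htr t
    rw [h2, k2] at e
    change toPU M • _ = _ at e
    rw [toPU_smul_pt] at e
    exact eq_of_pt_eq _ k1 (by rw [lor_omat, lor_line hv hw hvw]) (lor_line hv hw hvw _)
      (forward_omat hM h1 h0) k0 e
  have hMv : omat M *ᵥ v = Real.cosh (ℓ / 2) • v + Real.sinh (ℓ / 2) • w := by
    have := hMl 0
    simpa [line] using this
  have hs : Real.sinh 1 ≠ 0 := (Real.sinh_pos_iff.2 one_pos).ne'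
  have hMw : omat M *ᵥ w = Real.sinh (ℓ / 2) • v + Real.cosh (ℓ / 2) • w := by
    have h := hMl 2
    rw [line, line, Matrix.mulVec_add, Matrix.mulVec_smul, Matrix.mulVec_smul, hMv,
      show (2 + ℓ) / 2 = 1 + ℓ / 2 by ring, show (2 : ℝ) / 2 = 1 by norm_num, Real.cosh_add,
      Real.sinh_add, ← eq_sub_iff_add_eq'] at h
    apply smul_right_injective _ hs
    simp only
    rw [h]
    module
  -- Determinant $1$ is needed here: a glide reflection along $A$ would reverse the normal.
  have hMn : omat M *ᵥ lcross v w = lcross v w := by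
    have h := lcross_omat M v w
    have hcs := Real.cosh_sq (ℓ / 2)
    rw [hMv, hMw, lcross_rotate, hcs, add_sub_cancel_left, one_smul, hdet, one_smul] at h
    exact h.symm
  have e : M = boostO (ℓ / 2) ⟨lcross v w, lor_frame_normal hv hw hvw⟩ := by
    apply O21_ext
    intro x
    rw [frame_expansion hv hw hvw x]
    simp only [Matrix.mulVec_add, Matrix.mulVec_smul, hMv, hMw, hMn, boostO_mulVec,
      boost_frame_left _ hv hvw, boost_frame_right _ hw hvw,
      boost_self (lor_frame_normal hv hw hvw)]
  rw [← e]
  exact ⟨rfl, hdet⟩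

/-! ### Discreteness -/

theorem continuous_toPU_boostO (L : ℝ) :
    Continuous fun m : {m : Fin 3 → ℝ // lor m m = 1} => toPU (boostO L m) := by
  have hmat : Continuous fun m : Fin 3 → ℝ => (boostMat L m).map (algebraMap ℝ ℂ) := by
    refine continuous_matrix fun i j => ?_
    simp only [Matrix.map_apply]
    refine Complex.continuous_ofReal.comp ?_
    fin_cases i <;> fin_cases j <;> simp [boostMat] <;> fun_prop
  have h : Continuous fun m : {m : Fin 3 → ℝ // lor m m = 1} => complexify (boostO L m) := by
    refine continuous_induced_rng.2 (Units.continuous_iff.2 ⟨?_, ?_⟩)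
    · exact hmat.comp continuous_subtype_val
    · exact hmat.comp (continuous_neg.comp continuous_subtype_val)
  exact continuous_quot_mk.comp h

theorem eventually_eq_of_tendsto_of_mem {Γ : Subgroup PU21} (hdisc : DiscreteTopology Γ)
    {φ : ℕ → PU21} {a : PU21} (hφ : ∀ k, φ k ∈ Γ) (ha : a ∈ Γ)
    (h : Filter.Tendsto φ Filter.atTop (nhds a)) : ∀ᶠ k in Filter.atTop, φ k = a := by
  obtain ⟨V, hV, hVa⟩ := isOpen_induced_iff.1 (isOpen_discrete ({⟨a, ha⟩} : Set Γ))
  have haV : a ∈ V := by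
    have : (⟨a, ha⟩ : Γ) ∈ Subtype.val ⁻¹' V := by rw [hVa]; rfl
    exact this
  filter_upwards [h.eventually_mem (hV.mem_nhds haV)] with k hk
  have : (⟨φ k, hφ k⟩ : Γ) ∈ Subtype.val ⁻¹' V := hk
  rw [hVa] at this
  exact congrArg Subtype.val this

/-- If a discrete group contains the translations of length `L` with normal vectors `p` and `p + x`
and an element that fixes `p` and contracts `x`, then `x = 0`. -/
theorem eq_zero_of_contracting {Γ : Subgroup PU21} (hdisc : DiscreteTopology Γ) {L : ℝ}
    (hL : 0 < L) {p x : Fin 3 → ℝ} (hp : lor p p = 1)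
    {P : O21} (hP : toPU P ∈ Γ) (hdet : (omat P).det = 1) (hPp : omat P *ᵥ p = p) {r : ℝ}
    (hr0 : 0 < r) (hr1 : r < 1) (hPx : omat P *ᵥ x = r • x)
    (hunit : ∀ s : ℝ, lor (p + s • x) (p + s • x) = 1)
    (h0 : toPU (boostO L ⟨p, hp⟩) ∈ Γ)
    (h1 : toPU (boostO L ⟨p + (1 : ℝ) • x, hunit 1⟩) ∈ Γ) : x = 0 := by
  let f : ℝ → {m : Fin 3 → ℝ // lor m m = 1} := fun s => ⟨p + s • x, hunit s⟩
  have hf : Continuous f := by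
    refine Continuous.subtype_mk ?_ _
    fun_prop
  have hf0 : f 0 = ⟨p, hp⟩ := Subtype.ext (by simp [f])
  -- Each conjugation by $P$ multiplies the deviation from $p$ by $r$, which produces group elements
  -- converging to the boost with normal $p$.
  have hmem : ∀ k : ℕ, toPU (boostO L (f (r ^ k))) ∈ Γ := by
    intro k
    induction k with
    | zero => simpa [f] using h1
    | succ k ih =>
      have e : f (r ^ (k + 1)) = conjNormal P (f (r ^ k)) := by
        refine Subtype.ext ?_
        simp only [f, conjNormal, hdet, one_smul, Matrix.mulVec_add, Matrix.mulVec_smul, hPp, hPx,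
          smul_smul, pow_succ]
      rw [e, ← conj_boostO, map_mul, map_mul, map_inv]
      exact Γ.mul_mem (Γ.mul_mem hP ih) (Γ.inv_mem hP)
  have hlim : Filter.Tendsto (fun k : ℕ => toPU (boostO L (f (r ^ k)))) Filter.atTop
      (nhds (toPU (boostO L ⟨p, hp⟩))) := by
    rw [← hf0]
    exact (((continuous_toPU_boostO L).comp hf).tendsto 0).comp
      (tendsto_pow_atTop_nhds_zero_of_lt_one hr0.le hr1)
  obtain ⟨k, hk⟩ := (eventually_eq_of_tendsto_of_mem hdisc hmem h0 hlim).exists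
  have e := congrArg Subtype.val (toPU_boostO_injective hL hk)
  have e' : r ^ k • x = 0 := by simpa [f] using e
  exact (smul_eq_zero.1 e').resolve_left (pow_pos hr0 k).ne'

theorem boostO_inv {L : ℝ} (m : {m : Fin 3 → ℝ // lor m m = 1}) (h : lor (-m.1) (-m.1) = 1) :
    (boostO L m)⁻¹ = boostO L ⟨-m.1, h⟩ := by
  apply O21_ext
  intro x
  conv_rhs => rw [← omat_mulVec_inv (boostO L m) x, boostO_mulVec, boostO_mulVec]
  exact (boost_neg_boost m.2 _).symm

/-- In a discrete group, the axes of two conjugate hyperbolic elements are not asymptotic. -/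
theorem conjNormal_eq_of_abs_eq_one {Γ : Subgroup PU21} (hdisc : DiscreteTopology Γ) {L : ℝ}
    (hL : 0 < L) {v w : Fin 3 → ℝ} (hv : lor v v = -1) (hw : lor w w = 1) (hvw : lor v w = 0)
    {n : {m : Fin 3 → ℝ // lor m m = 1}} (hn : n.1 = lcross v w) (hγ : toPU (boostO L n) ∈ Γ)
    (hdet : (omat (boostO L n)).det = 1) {m : {m : Fin 3 → ℝ // lor m m = 1}}
    (hm : toPU (boostO L m) ∈ Γ) (h : |lor m.1 n.1| = 1) : m.1 = lor m.1 n.1 • n.1 := by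
  set ε := lor m.1 n.1 with hε
  have hε2 : ε * ε = 1 := by rw [← abs_mul_abs_self, h, one_mul]
  have ex := frame_expansion hv hw hvw m
  rw [← hn, ← hε] at ex
  generalize -lor m.1 v = a at ex
  generalize lor m.1 w = b at ex
  have hvn : lor v n.1 = 0 := by rw [hn, lor_comm, lor_lcross_self_left]
  have hwn : lor w n.1 = 0 := by rw [hn, lor_comm, lor_lcross_self_right]
  -- Since $m$ and $n$ are unit with product $\pm1$, the difference $av+bw$ is null, hence an
  -- eigenvector of the boost for $e^{L}$ or $e^{-L}$ if nonzero.
  have hab : (b - a) * (b + a) = 0 := by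
    have := m.2
    rw [ex] at this
    simp only [lor_add_left, lor_add_right, lor_smul_left, lor_smul_right, hv, hw, hvw,
      lor_comm w v, lor_comm n.1, hvn, hwn, n.2] at this
    linear_combination this - hε2
  have hp : lor (ε • n.1) (ε • n.1) = 1 := by
    rw [lor_smul_left, lor_smul_right, n.2, mul_one, hε2]
  have hfix : omat (boostO L n) *ᵥ (ε • n.1) = ε • n.1 := by
    rw [Matrix.mulVec_smul, boostO_mulVec, boost_self n.2]
  have hp0 : toPU (boostO L ⟨ε • n.1, hp⟩) ∈ Γ := by
    rcases mul_self_eq_one_iff.1 hε2 with e | e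
    · simpa [e] using hγ
    · have hneg : lor (-n.1) (-n.1) = 1 := by rw [lor_neg_left, lor_neg_right, neg_neg, n.2]
      have := Γ.inv_mem hγ
      rw [← map_inv, boostO_inv n hneg] at this
      simpa [e] using this
  suffices hx : a • v + b • w = 0 by rw [ex, hx, zero_add]
  have hpx : lor (ε • n.1) (a • v + b • w) = 0 := by
    simp only [lor_add_right, lor_smul_left, lor_smul_right, lor_comm n.1, hvn, hwn]
    ring
  have hxx : lor (a • v + b • w) (a • v + b • w) = 0 := by
    simp only [lor_add_left, lor_add_right, lor_smul_left, lor_smul_right, hv, hw, hvw,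
      lor_comm w v]
    linear_combination hab
  have hunit : ∀ s : ℝ, lor (ε • n.1 + s • (a • v + b • w)) (ε • n.1 + s • (a • v + b • w)) = 1 := by
    generalize ε • n.1 = p at hp hpx
    generalize a • v + b • w = x at hpx hxx
    intro s
    simp only [lor_add_left, lor_add_right, lor_smul_left, lor_smul_right, hp, hpx, hxx,
      lor_comm x p]
    ring
  have h1 : toPU (boostO L ⟨ε • n.1 + (1 : ℝ) • (a • v + b • w), hunit 1⟩) ∈ Γ := by
    have e : m = ⟨ε • n.1 + (1 : ℝ) • (a • v + b • w), hunit 1⟩ := by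
      refine Subtype.ext ?_
      simp only
      rw [one_smul, add_comm]
      exact ex
    rwa [← e]
  have hbv : omat (boostO L n) *ᵥ v = Real.cosh L • v + Real.sinh L • w := by
    rw [boostO_mulVec, hn, boost_frame_left _ hv hvw]
  have hbw : omat (boostO L n) *ᵥ w = Real.sinh L • v + Real.cosh L • w := by
    rw [boostO_mulVec, hn, boost_frame_right _ hw hvw]
  have hr1 : Real.exp (-L) < 1 := Real.exp_zero ▸ Real.exp_lt_exp.2 (by linarith)
  rcases mul_eq_zero.1 hab with hb | hb
  · have hb' : b = a := by linarith
    have hexp : omat (boostO L n) *ᵥ (a • v + b • w) = Real.exp L • (a • v + b • w) := by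
      rw [Matrix.mulVec_add, Matrix.mulVec_smul, Matrix.mulVec_smul, hbv, hbw, hb',
        ← Real.cosh_add_sinh]
      module
    -- The boost expands this null direction, so its inverse does the contracting.
    refine eq_zero_of_contracting hdisc hL hp (P := (boostO L n)⁻¹)
      (by rw [map_inv]; exact Γ.inv_mem hγ) ?_ ?_ (Real.exp_pos _) hr1 ?_ hunit hp0 h1
    · have := congrArg (fun N => (omat N).det) (mul_inv_cancel (boostO L n))
      simp only [omat_mul, Matrix.det_mul, hdet, one_mul] at this
      rw [this]
      exact Matrix.det_one
    · conv_lhs => rw [← hfix]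
      exact omat_inv_mulVec _ _
    · have : a • v + b • w = Real.exp (-L) • (omat (boostO L n) *ᵥ (a • v + b • w)) := by
        rw [hexp, smul_smul, ← Real.exp_add, neg_add_cancel, Real.exp_zero, one_smul]
      conv_lhs => rw [this]
      rw [Matrix.mulVec_smul, omat_inv_mulVec]
  · have hb' : b = -a := by linarith
    refine eq_zero_of_contracting hdisc hL hp hγ hdet hfix (Real.exp_pos _) hr1 ?_ hunit
      hp0 h1
    rw [Matrix.mulVec_add, Matrix.mulVec_smul, Matrix.mulVec_smul, hbv, hbw, hb',
      ← Real.cosh_sub_sinh]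
    module

/-! ### The collar -/

theorem pt_mem_geod_iff {u m : Fin 3 → ℝ} (hu : lor u u < 0) :
    pt u hu ∈ geod m ↔ lor u m = 0 := by
  refine ⟨?_, fun h => ⟨u, hu, rfl, h⟩⟩
  rintro ⟨u', hu', e, h⟩
  obtain ⟨a, ha⟩ := (Projectivization.mk_eq_mk_iff' ℂ _ _ _ _).1 (congrArg Subtype.val e)
  have : (lor u m : ℂ) = a * (lor u' m : ℂ) := by
    rw [← herm_cvec, ← herm_cvec, ← herm_smul_left, ha]
  rw [h, Complex.ofReal_zero, mul_zero] at this
  exact_mod_cast this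

/-- Orthogonality at the times $0$ and $2$ makes $q$ orthogonal to both $v$ and $w$. -/
theorem eq_smul_of_geod_eq {v w q : Fin 3 → ℝ} (hv : lor v v = -1) (hw : lor w w = 1)
    (hvw : lor v w = 0) (h : geod q = geod (lcross v w)) :
    q = lor q (lcross v w) • lcross v w := by
  have key : ∀ t, lor (line v w t) q = 0 := fun t => by
    have ht : lor (line v w t) (line v w t) < 0 := by rw [lor_line hv hw hvw]; norm_num
    rw [← pt_mem_geod_iff ht, h, pt_mem_geod_iff]
    exact lor_line_normal v w t
  have h0 : lor v q = 0 := by simpa [line] using key 0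
  have h2 : lor w q = 0 := by
    have := key 2
    rw [line, lor_add_left, lor_smul_left, lor_smul_left, h0, mul_zero, zero_add,
      div_self two_ne_zero] at this
    exact (mul_eq_zero.1 this).resolve_left (Real.sinh_pos_iff.2 one_pos).ne'
  have ex := frame_expansion hv hw hvw q
  rw [lor_comm q v, lor_comm q w, h0, h2] at ex
  simpa using ex

theorem abs_lor_conjNormal (N : O21) (m : {m : Fin 3 → ℝ // lor m m = 1}) (x : Fin 3 → ℝ) :
    |lor (conjNormal N m) x| = |lor (omat N *ᵥ m.1) x| := by
  rw [conjNormal, lor_smul_left, abs_mul]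
  rcases det_omat N with h | h <;> rw [h] <;> norm_num

/-- The collar theorem for an axis whose translates coincide with it or miss it. -/
theorem one_le_of_smul_ne {Γ : Subgroup PU21} (hdisc : DiscreteTopology Γ) {L : ℝ}
    (hL : 0 < L) {v w : Fin 3 → ℝ} (hv : lor v v = -1) (hw : lor w w = 1) (hvw : lor v w = 0)
    {n : {m : Fin 3 → ℝ // lor m m = 1}} (hn : n.1 = lcross v w) (hγ : toPU (boostO L n) ∈ Γ)
    (hdet : (omat (boostO L n)).det = 1)
    (hsimple : ∀ g ∈ Γ, g • geod n = geod n ∨ (g • geod n) ∩ geod n = ∅)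
    {N : O21} (hN : toPU N ∈ Γ) (hNA : toPU N • geod n ≠ geod n) :
    1 ≤ (Real.cosh L - 1) * (|lor (conjNormal N n).1 n.1| - 1) := by
  have hmem : ∀ N : O21, toPU N ∈ Γ → toPU (boostO L (conjNormal N n)) ∈ Γ := by
    intro N hN
    rw [← conj_boostO, map_mul, map_mul, map_inv]
    exact Γ.mul_mem (Γ.mul_mem hN hγ) (Γ.inv_mem hN)
  have gt_one : ∀ N : O21, toPU N ∈ Γ → toPU N • geod n ≠ geod n →
      1 < |lor (conjNormal N n).1 n.1| := by
    intro N hN hNA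
    by_contra hcon
    rcases (not_lt.1 hcon).lt_or_eq with h | h
    · have := geod_inter_nonempty (conjNormal N n).2 n.2 h
      rw [geod_conjNormal, (hsimple _ hN).resolve_left hNA] at this
      exact Set.not_nonempty_empty this
    · have e := conjNormal_eq_of_abs_eq_one hdisc hL hv hw hvw hn hγ hdet (hmem N hN) h
      apply hNA
      rw [← geod_conjNormal, e]
      exact geod_smul (fun h0 => by rw [h0] at h; simp at h) _
  have hcosh : 1 < Real.cosh L := Real.one_lt_cosh.2 hL.ne'
  have step : ∀ N : O21, toPU N ∈ Γ → toPU N • geod n ≠ geod n →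
      ∃ N' : O21, toPU N' ∈ Γ ∧ toPU N' • geod n ≠ geod n ∧
        |lor (conjNormal N' n).1 n.1| + 1 = (Real.cosh L - 1) * (|lor (conjNormal N n).1 n.1| - 1)
          * (|lor (conjNormal N n).1 n.1| + 1) := by
    intro N hN hNA
    have hc := gt_one N hN hNA
    set m := conjNormal N n with hm
    have hsq : 1 < lor m.1 n.1 ^ 2 := by
      rw [← sq_abs]; nlinarith
    have hpos : 0 < (Real.cosh L - 1) * (lor m.1 n.1 ^ 2 - 1) :=
      mul_pos (by linarith) (by linarith)
    have hq : lor (boost L m n) n.1 = 1 - (Real.cosh L - 1) * (lor m.1 n.1 ^ 2 - 1) := by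
      rw [boost, lor_add_left, lor_add_left, lor_smul_left, lor_smul_left, lor_smul_left,
        lor_lcross_self_right, n.2, lor_comm n.1 m.1]
      ring
    -- If the boost along $gA$ preserved $A$, then $n$ would be an eigenvector. The boost preserves
    -- $\langle n,m\rangle\ne0$, so the eigenvalue would be $1$, but by `hq` it is less than $1$.
    have hne : toPU (boostO L m) • geod n ≠ geod n := by
      intro hA
      rw [smul_geod, boostO_mulVec] at hA
      have e := eq_smul_of_geod_eq hv hw hvw (hA.trans (by rw [hn]))
      rw [← hn] at e
      have h1 : lor (boost L m n) n.1 * lor m.1 n.1 = lor m.1 n.1 := by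
        have := lor_boost_self (L := L) m.2 n.1
        rw [e, lor_smul_left, lor_comm n.1 m.1] at this
        exact this
      have h0 : lor m.1 n.1 ≠ 0 := by
        intro h0
        rw [h0] at hsq
        norm_num at hsq
      have h2 := mul_right_cancel₀ h0 (h1.trans (one_mul _).symm)
      linarith
    refine ⟨boostO L m, hmem N hN, hne, ?_⟩
    have h1 := gt_one _ (hmem N hN) hne
    rw [abs_lor_conjNormal, boostO_mulVec, hq] at h1 ⊢
    -- The product is less than $1$, yet its absolute value exceeds $1$; hence it is negative, which
    -- gives the recursion for $C'+1$.
    have hneg : 1 - (Real.cosh L - 1) * (lor m.1 n.1 ^ 2 - 1) < 0 := by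
      by_contra hcon
      rw [abs_of_nonneg (not_lt.1 hcon)] at h1
      linarith
    rw [abs_of_neg hneg, ← sq_abs]
    ring
  by_contra hcon
  set C := |lor (conjNormal N n).1 n.1| with hC
  set q := (Real.cosh L - 1) * (C - 1) with hq
  have hq1 : q < 1 := not_le.1 hcon
  have hC1 : 1 < C := gt_one N hN hNA
  have hq0 : 0 < q := mul_pos (by linarith) (by linarith)
  have iter : ∀ k : ℕ, ∃ N' : O21, toPU N' ∈ Γ ∧ toPU N' • geod n ≠ geod n ∧
      |lor (conjNormal N' n).1 n.1| + 1 ≤ q ^ k * (C + 1) := by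
    intro k
    induction k with
    | zero => exact ⟨N, hN, hNA, by rw [pow_zero, one_mul]⟩
    | succ k ih =>
      obtain ⟨N', h1, h2, h3⟩ := ih
      obtain ⟨N'', h4, h5, h6⟩ := step N' h1 h2
      have h7 := gt_one N' h1 h2
      refine ⟨N'', h4, h5, ?_⟩
      -- The constants never exceed the initial $C$, so the contraction factor stays at most $q$.
      have hle : |lor (conjNormal N' n).1 n.1| ≤ C := by
        have := mul_le_of_le_one_left (by linarith : 0 ≤ C + 1) (pow_le_one₀ (n := k) hq0.le hq1.le)
        linarith
      rw [h6, pow_succ']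
      calc _ ≤ q * (|lor (conjNormal N' n).1 n.1| + 1) := by
            gcongr
            rw [hq]
            gcongr
        _ ≤ q * (q ^ k * (C + 1)) := by gcongr
        _ = _ := by ring
  obtain ⟨k, hk⟩ := exists_pow_lt_of_lt_one (show (0 : ℝ) < 2 / (C + 1) by positivity) hq1
  obtain ⟨N', h1, h2, h3⟩ := iter k
  have h4 := gt_one N' h1 h2
  rw [lt_div_iff₀ (by linarith)] at hk
  linarith

/-! ### Precise invariance and the sides of the Dirichlet polyhedron -/

theorem chDist_nonneg (x y : CH2) : 0 ≤ chDist x y := by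
  obtain ⟨v, hv, hx, h1⟩ := exists_unit_rep x
  obtain ⟨w, hw, hy, h2⟩ := exists_unit_rep y
  rw [chDist_of_unit hv hw hx hy h1 h2]
  exact mul_nonneg zero_le_two (Real.arcosh_nonneg (one_le_norm_herm h1 h2))

theorem chDist_inv_smul (g : PU21) (x y : CH2) : chDist x (g⁻¹ • y) = chDist (g • x) y := by
  rw [← chDist_smul g, smul_inv_smul]

/-- The distance of the axis to its other translates. -/
theorem two_mul_le_chDist {Γ : Subgroup PU21} (hΓ : Γ ≤ PO21) (hdisc : DiscreteTopology Γ)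
    {γ : PU21} (hγ : γ ∈ Γ) {A : Set CH2} {ℓ : ℝ} (hA : IsHyperbolicWith γ A ℓ)
    (hsimple : ∀ g ∈ Γ, g • A = A ∨ (g • A) ∩ A = ∅)
    {δ : ℝ} (hδ : 0 < δ) (h : Real.sinh (ℓ / 4) * Real.sinh (δ / 2) ≤ 1 / 2)
    {g : PU21} (hg : g ∈ Γ) (hgA : g • A ≠ A) {x y : CH2} (hx : x ∈ g • A) (hy : y ∈ A) :
    2 * δ ≤ chDist x y := by
  have hℓ : 0 < ℓ := hA.2.1
  obtain ⟨v, w, n, hv, hw, hvw, hn, rfl, rfl, hdet⟩ := exists_boost_of_isHyperbolicWith hA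
  obtain ⟨N, rfl⟩ := hΓ hg
  change toPU N • geod n ≠ geod n at hgA
  change x ∈ toPU N • geod n at hx
  have hcollar := one_le_of_smul_ne hdisc (half_pos hℓ) hv hw hvw hn hγ hdet hsimple hg hgA
  rw [← geod_conjNormal] at hx
  have hC := abs_lor_le_cosh (conjNormal N n).2 n.2 hx hy
  have e1 : Real.cosh (ℓ / 2) - 1 = 2 * Real.sinh (ℓ / 4) ^ 2 := by
    rw [show ℓ / 2 = 2 * (ℓ / 4) by ring, Real.cosh_two_mul, Real.cosh_sq]; ring
  have e2 : Real.cosh δ = 1 + 2 * Real.sinh (δ / 2) ^ 2 := by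
    conv_lhs => rw [show δ = 2 * (δ / 2) by ring, Real.cosh_two_mul, Real.cosh_sq]
    ring
  have hs1 : 0 < Real.sinh (ℓ / 4) := Real.sinh_pos_iff.2 (by linarith)
  have hs2 : 0 < Real.sinh (δ / 2) := Real.sinh_pos_iff.2 (by linarith)
  have hsq : (Real.sinh (ℓ / 4) * Real.sinh (δ / 2)) ^ 2 ≤ (1 / 2) ^ 2 := by gcongr
  -- The hypothesis squared gives $(\cosh(\ell/2)-1)(\cosh\delta-1)\le1$, to be compared with the
  -- collar bound.
  have hle : Real.cosh δ ≤ |lor (conjNormal N n).1 n.1| := by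
    rw [e1] at hcollar
    rw [e2]
    have h2 : 2 * Real.sinh (ℓ / 4) ^ 2 * (2 * Real.sinh (δ / 2) ^ 2)
        ≤ 2 * Real.sinh (ℓ / 4) ^ 2 * (|lor (conjNormal N n).1 n.1| - 1) := by
      rw [mul_pow] at hsq; linarith
    have := le_of_mul_le_mul_left h2 (by positivity)
    linarith
  have := Real.cosh_le_cosh.1 (hle.trans hC)
  rw [abs_of_pos hδ, abs_of_nonneg (by linarith [chDist_nonneg x y])] at this
  linarith

theorem smul_mem_tube {g : PU21} {A : Set CH2} (hg : g • A = A) {δ : ℝ} {x : CH2}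
    (hx : x ∈ tube A δ) : g • x ∈ tube A δ := by
  obtain ⟨a, ha, h⟩ := hx
  exact ⟨g • a, hg ▸ Set.smul_mem_smul_set ha, by rwa [chDist_smul]⟩

theorem smul_tube {g : PU21} {A : Set CH2} (hg : g • A = A) (δ : ℝ) :
    g • tube A δ = tube A δ := by
  ext x
  rw [Set.mem_smul_set_iff_inv_smul_mem]
  refine ⟨fun h => by simpa using smul_mem_tube hg h, fun h => smul_mem_tube ?_ h⟩
  rw [inv_smul_eq_iff, hg]

/-- A point common to two tubes would join a point of $gA$ to a point of $A$ by a path shorter than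
$2\delta$. -/
theorem isPreciselyInvariant_tube {Γ : Subgroup PU21} {A : Set CH2} {δ : ℝ}
    (hd : ∀ g ∈ Γ, g • A ≠ A → ∀ x ∈ g • A, ∀ y ∈ A, 2 * δ ≤ chDist x y) :
    IsPreciselyInvariant Γ (stab Γ A) (tube A δ) := by
  refine ⟨fun g hg => smul_tube hg.2 δ, fun g hg hgA => ?_⟩
  rw [Set.eq_empty_iff_forall_notMem]
  rintro w ⟨⟨w', ⟨a, ha, haw⟩, rfl⟩, b, hb, hbw⟩
  have h1 := hd g hg (fun e => hgA ⟨hg, e⟩) (g • a) (Set.smul_mem_smul_set ha) b hb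
  have h2 := chDist_triangle (g • a) (g • w') b
  simp only at hbw
  rw [chDist_smul, chDist_comm a w'] at h2
  linarith

theorem zpow_smul_translate {γ : PU21} {c : ℝ → CH2} {ℓ : ℝ} (h : ∀ t, γ • c t = c (t + ℓ))
    (n : ℤ) (t : ℝ) : γ ^ n • c t = c (t + n * ℓ) := by
  have hn : ∀ (k : ℕ) t, γ ^ k • c t = c (t + k * ℓ) := by
    intro k
    induction k with
    | zero => simp
    | succ k ih =>
      intro t
      rw [pow_succ, mul_smul, h, ih]
      congr 1; push_cast; ring
  obtain ⟨k, rfl | rfl⟩ := n.eq_nat_or_neg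
  · simpa using hn k t
  · rw [zpow_neg, zpow_natCast, inv_smul_eq_iff, hn]
    congr 1; push_cast; ring

/-- The sides lie in the bisectors of $z$ with $\gamma^{-1}z$ and $\gamma z$, and contain the
midpoints. The index $e=\pm1$ treats both at once. -/
theorem dirichlet_sides {Γ : Subgroup PU21} {A : Set CH2} {δ ℓ : ℝ} {γ : PU21} (hγ : γ ∈ Γ)
    (hd : ∀ g ∈ Γ, g • A ≠ A → ∀ x ∈ g • A, ∀ y ∈ A, 2 * δ ≤ chDist x y) (hℓ : 0 < ℓ)
    (hℓδ : ℓ < 4 * δ) {c : ℝ → CH2} (hcA : Set.range c = A)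
    (hc : ∀ s t, chDist (c s) (c t) = |s - t|) (htr : ∀ t, γ • c t = c (t + ℓ))
    (hstab : ∀ g ∈ stab Γ A, ∃ n : ℤ, ∀ x ∈ A, g • x = γ ^ n • x) {z : CH2} (hz : z ∈ A) :
    ∃ σ σ' : Set CH2, IsSide Γ z σ ∧ IsSide Γ z σ' ∧ σ ≠ σ' ∧
      (σ ∩ A).Nonempty ∧ (σ' ∩ A).Nonempty ∧ γ • σ = σ' := by
  have hmem : ∀ t, c t ∈ A := fun t => hcA ▸ Set.mem_range_self t
  obtain ⟨t, rfl⟩ : z ∈ Set.range c := hcA ▸ hz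
  -- the orbit points other than `c t` and its two neighbours are far from the midpoints
  have far : ∀ e : ℤ, (e = 1 ∨ e = -1) → ∀ g ∈ Γ, g • c t = c t ∨ g • c t = c (t + e * ℓ) ∨
      ℓ / 2 + min ℓ (2 * δ - ℓ / 2) ≤ chDist (g • c t) (c (t + e * ℓ / 2)) := by
    intro e he g hg
    by_cases hgA : g • A = A
    · obtain ⟨k, hk⟩ := hstab g ⟨hg, hgA⟩
      rw [hk _ (hmem t), zpow_smul_translate htr, hc]
      by_cases hk0 : k = 0
      · left; simp [hk0]
      by_cases hke : k = e
      · right; left; rw [hke]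
      right; right
      -- An integer other than $0$ and $e=\pm1$ is at distance at least $3/2$ from $e/2$.
      have habs : 3 / 2 * ℓ ≤ |t + k * ℓ - (t + e * ℓ / 2)| := by
        rw [show t + k * ℓ - (t + e * ℓ / 2) = (k - e / 2) * ℓ by ring, abs_mul, abs_of_pos hℓ]
        gcongr
        rw [le_abs]
        rcases he with rfl | rfl
        · rcases lt_or_gt_of_ne hk0 with h | h
          · right
            have : (k : ℝ) ≤ -1 := by exact_mod_cast (show k ≤ -1 by omega)
            push_cast; linarith
          · left
            have : (2 : ℝ) ≤ k := by exact_mod_cast (show 2 ≤ k by omega)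
            push_cast; linarith
        · rcases lt_or_gt_of_ne hk0 with h | h
          · right
            have : (k : ℝ) ≤ -2 := by exact_mod_cast (show k ≤ -2 by omega)
            push_cast; linarith
          · left
            have : (1 : ℝ) ≤ k := by exact_mod_cast (show 1 ≤ k by omega)
            push_cast; linarith
      linarith [min_le_left ℓ (2 * δ - ℓ / 2)]
    · right; right
      have := hd g hg hgA _ (Set.smul_mem_smul_set (hmem t)) _ (hmem (t + e * ℓ / 2))
      linarith [min_le_right ℓ (2 * δ - ℓ / 2)]
  -- This is the margin by which the other orbit points are farther from the midpoint;
  -- $\ell<4\delta$ makes it positive. Moving by less than half of it keeps the order of the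
  -- distances.
  have hεpos : 0 < min ℓ (2 * δ - ℓ / 2) := lt_min hℓ (by linarith)
  set ε := min ℓ (2 * δ - ℓ / 2) with hε
  have near : ∀ e : ℤ, (e = 1 ∨ e = -1) → chDist (c t) (c (t + e * ℓ / 2)) = ℓ / 2 ∧
      chDist (c (t + e * ℓ)) (c (t + e * ℓ / 2)) = ℓ / 2 := by
    intro e he
    rw [hc, hc]
    rcases he with rfl | rfl
    · constructor
      · rw [abs_of_neg] <;> push_cast <;> linarith
      · rw [abs_of_pos] <;> push_cast <;> linarith
    · constructor
      · rw [abs_of_pos] <;> push_cast <;> linarith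
      · rw [abs_of_neg] <;> push_cast <;> linarith
  have mem_dirichlet : ∀ e : ℤ, (e = 1 ∨ e = -1) → ∀ u ∈ bisector (c t) (c (t + e * ℓ)),
      chDist u (c (t + e * ℓ / 2)) < ε / 2 → u ∈ dirichlet Γ (c t) := by
    intro e he u hu hud g hg
    rcases far e he g hg with h | h | h
    · rw [h]
    · rw [h]; exact le_of_eq hu
    · have h1 := chDist_triangle (c t) (c (t + e * ℓ / 2)) u
      have h2 := chDist_triangle (g • c t) u (c (t + e * ℓ / 2))
      rw [(near e he).1, chDist_comm (c (t + e * ℓ / 2)) u] at h1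
      linarith
  have mid_mem : ∀ e : ℤ, (e = 1 ∨ e = -1) → c (t + e * ℓ / 2) ∈
      dirichlet Γ (c t) ∩ bisector (c t) (c (t + e * ℓ)) := by
    intro e he
    have hb : c (t + e * ℓ / 2) ∈ bisector (c t) (c (t + e * ℓ)) := by
      change chDist _ _ = chDist _ _
      rw [(near e he).1, (near e he).2]
    refine ⟨mem_dirichlet e he _ hb ?_, hb⟩
    rw [hc, sub_self, abs_zero]
    exact half_pos hεpos
  have side : ∀ e : ℤ, (e = 1 ∨ e = -1) →
      IsSide Γ (c t) (dirichlet Γ (c t) ∩ bisector (c t) (c (t + e * ℓ))) := by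
    intro e he
    have hγe := zpow_smul_translate htr e t
    refine ⟨γ ^ e, Γ.zpow_mem hγ e, ?_, by rw [hγe], c (t + e * ℓ / 2), mid_mem e he, ε / 2,
      half_pos hεpos, ?_⟩
    · intro h0
      rw [hγe] at h0
      have h1 := hc (t + e * ℓ) t
      rw [h0, hc, sub_self, abs_zero, add_sub_cancel_left] at h1
      rcases he with rfl | rfl <;> simp at h1 <;> exact hℓ.ne (h1.trans (abs_of_pos hℓ))
    · intro u hu hud
      rw [hγe] at hu
      exact ⟨mem_dirichlet e he u hu hud, hu⟩
  refine ⟨_, _, side (-1) (Or.inr rfl), side 1 (Or.inl rfl), ?_,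
    ⟨_, mid_mem (-1) (Or.inr rfl), hmem _⟩, ⟨_, mid_mem 1 (Or.inl rfl), hmem _⟩, ?_⟩
  · intro h
    have h1 := mid_mem 1 (Or.inl rfl)
    rw [← h] at h1
    have h2 : chDist _ _ = chDist _ _ := h1.2
    rw [hc, hc, abs_of_neg (by push_cast; linarith), abs_of_neg (by push_cast; linarith)] at h2
    push_cast at h2
    linarith
  · have e1 : t + ((1 : ℤ) : ℝ) * ℓ = t + ℓ := by push_cast; ring
    have e2 : t + ((-1 : ℤ) : ℝ) * ℓ = t - ℓ := by push_cast; ring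
    rw [e1, e2]
    ext x
    rw [Set.mem_smul_set_iff_inv_smul_mem]
    simp only [dirichlet, bisector, Set.mem_inter_iff, Set.mem_ofPred_eq, chDist_inv_smul, htr,
      sub_add_cancel]
    -- Reindexing by $\gamma\Gamma=\Gamma$ makes $\gamma\sigma$ part of the polyhedron centered at
    -- $\gamma z$. On the bisector of $z$ and $\gamma z$ the two centers are interchangeable.
    have key : (∀ g ∈ Γ, chDist (c (t + ℓ)) x ≤ chDist (γ • g • c t) x) ↔
        ∀ g ∈ Γ, chDist (c (t + ℓ)) x ≤ chDist (g • c t) x := by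
      refine ⟨fun h g hg => ?_, fun h g hg => ?_⟩
      · have := h (γ⁻¹ * g) (Γ.mul_mem (Γ.inv_mem hγ) hg)
        rwa [mul_smul, smul_inv_smul] at this
      · rw [← mul_smul]
        exact h _ (Γ.mul_mem hγ hg)
    rw [key]
    exact ⟨fun ⟨h1, h2⟩ => ⟨h2 ▸ h1, h2.symm⟩, fun ⟨h1, h2⟩ => ⟨h2 ▸ h1, h2.symm⟩⟩

end CplxHyp

end

open CplxHyp in
theorem corollary3p3 (Γ : Subgroup PU21) (hΓ : Γ ≤ PO21) (hdisc : DiscreteTopology Γ)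
    (hne : IsNonElementary Γ)
    (γ : PU21) (hγ : γ ∈ Γ) (A : Set CH2) (ℓ : ℝ) (hA : IsHyperbolicWith γ A ℓ)
    -- the closed geodesic `A / ⟨γ⟩` is simple: the translates of `A` coincide with it or miss it
    (hsimple : ∀ g ∈ Γ, g • A = A ∨ (g • A) ∩ A = ∅)
    (δ : ℝ) (hδ : 0 < δ) (h : Real.sinh (ℓ / 4) * Real.sinh (δ / 2) ≤ 1 / 2) :
    IsPreciselyInvariant Γ (stab Γ A) (tube A δ) ∧
      -- if `γ` generates the action of the stabilizer of `A` on `A`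
      -- (for example, if it generates the stabilizer)
      ((∀ g ∈ stab Γ A, ∃ n : ℤ, ∀ x ∈ A, g • x = γ ^ n • x) → ℓ < 4 * δ →
        ∀ z ∈ A, ∃ σ σ' : Set CH2, IsSide Γ z σ ∧ IsSide Γ z σ' ∧ σ ≠ σ' ∧
          (σ ∩ A).Nonempty ∧ (σ' ∩ A).Nonempty ∧ γ • σ = σ') := by
  obtain ⟨c, hcA, -, hc, htr⟩ := hA.2.2
  have hd : ∀ g ∈ Γ, g • A ≠ A → ∀ x ∈ g • A, ∀ y ∈ A, 2 * δ ≤ chDist x y :=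
    fun g hg hgA x hx y hy => two_mul_le_chDist hΓ hdisc hγ hA hsimple hδ h hg hgA hx hy
  exact ⟨isPreciselyInvariant_tube hd, fun hstab hℓδ z hz =>
    dirichlet_sides hγ hd hA.2.1 hℓδ hcA hc htr hstab hz⟩
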